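/- Let $\mathbb Z_-$ be the set of non-positive integers. All filtrations are non-decreasing sequences $(\mathcal F_n)_{n\in\mathbb Z_-}$ of complete, essentially separable sub-$\sigma$-fields of a probability space. A filtration is \emph{of product type} if it is the completed natural filtration of a sequence $(V_n)_{n\le 0}$ of independent random variables. A filtration $\mathcal F$ is \emph{immersed} in a filtration $\mathcal H$ on the same probability space if, for every $n\le 0$, $\mathcal F_n\subset\mathcal H_n$ and $\mathcal F_n$ is independent of $\mathcal H_{n-1}$ conditionally on $\mathcal F_{n-1}$. An \emph{isomorphism} between filtrations $\mathcal F$ and $\mathcal F'$, on possibly different probability spaces, is a bijection $\Psi:L^0(\mathcal F_0)\to L^0(\mathcal F'_0)$ between the spaces of (classes of) real random variables which preserves laws, commutes with Borel maps $\mathbb R^{\mathbb N}\to\mathbb R$, and is such that for every $n\le0$ the random variables $\Psi(X)$, $X\in L^0(\mathcal F_n)$, generate the complete $\sigma$-field $\mathcal F'_n$. A filtration is \emph{standard} if it is isomorphic to a filtration which is immersed in some product-type filtration. A filtration $\mathcal F$ is \emph{at the threshold of standardness} if it is not standard, but $(\mathcal F_{\psi(n)})_{n\le 0}$ is standard for every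 strictly increasing map $\psi:\mathbb Z_-\to\mathbb Z_-$ whose range omits infinitely many elements of $\mathbb Z_-$. Let $(\mathcal F_n)_{n\le 0}$ be a filtration at the threshold of standardness. Define the strictly increasing map $\phi:\mathbb Z_-\to\mathbb Z_-$ by $\phi(0)=0$, $\phi(-1)=-1$ and, for every integer $k\le -1$, $$\phi(2k)=-2^{|k|},\qquad \phi(2k-1)=-2^{|k|}-1 .$$ Let $\mathcal G$ be the slowed filtration defined, for $n\le 0$, by $\mathcal G_n=\mathcal F_k$, where $k\le 0$ is the unique integer such that $\phi(k-1)+1\le n\le\phi(k)$. Then for every integer $d\ge 1$, the filtration $(\mathcal G_{2^dn})_{n\le 0}$ is not standard, whereas the filtration $(\mathcal G_{2^dn-2^{d-1}})_{n\le 0}$ is standard. -/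

import Mathlib

open MeasureTheory ProbabilityTheory

universe u v

namespace Standardness

/-- The non-positive integers, with the usual order. -/
abbrev NonposInt : Type := {n : ℤ // n ≤ 0}

instance : Zero NonposInt := ⟨⟨0, le_rfl⟩⟩

/-- `n - 1`. -/
def pred (n : NonposInt) : NonposInt := ⟨(n : ℤ) - 1, by have := n.2; omega⟩

/-- The complete σ-field generated by `m` with respect to `P`: all sets which are almost surely equal
to some element of `m`. -/
abbrev completion {Ω : Type u} [MeasurableSpace Ω] (P : Measure Ω) (m : MeasurableSpace Ω) :
    MeasurableSpace Ω :=
  eventuallyMeasurableSpace m (ae P)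

/-- Filtrations indexed by the non-positive integers on the probability space `(Ω, mΩ, P)`:
non-decreasing sequences of sub-σ-fields of `mΩ`, all complete and essentially separable
(generated, as complete σ-fields, by a sequence of events). -/
structure NegFiltration {Ω : Type u} [mΩ : MeasurableSpace Ω] (P : Measure Ω) extends
    Filtration NonposInt mΩ where
  complete : ∀ (n : NonposInt) (s : Set Ω), P s = 0 → MeasurableSet[seq n] s
  separable : ∀ n : NonposInt, ∃ e : ℕ → Set Ω,
    seq n = completion P (MeasurableSpace.generateFrom (Set.range e))

instance {Ω : Type u} [MeasurableSpace Ω] (P : Measure Ω) :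
    CoeFun (NegFiltration P) (fun _ => NonposInt → MeasurableSpace Ω) := ⟨fun F => F.seq⟩

/-- The filtration `(F_{φ(n)})_{n ≤ 0}` extracted from `F` by an increasing map `φ`. -/
def NegFiltration.extract {Ω : Type u} [MeasurableSpace Ω] {P : Measure Ω}
    (F : NegFiltration P) (φ : NonposInt → NonposInt) (hφ : StrictMono φ) : NegFiltration P where
  seq n := F (φ n)
  mono' _ _ h := F.mono' (hφ.monotone h)
  le' n := F.le' (φ n)
  complete n := F.complete (φ n)
  separable n := F.separable (φ n)

/-- `L⁰(Ω, m, P)`: almost sure classes of `m`-measurable real random variables. -/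
def L0 {Ω : Type u} (m : MeasurableSpace Ω) [MeasurableSpace Ω] (P : Measure Ω) :
    Set (Ω →ₘ[P] ℝ) :=
  {X | AEStronglyMeasurable[m] (X : Ω → ℝ) P}

/-- Isomorphism of filtered probability spaces: a bijection `Ψ` from `L⁰(F_∞)` onto `L⁰(F'_∞)` which
preserves laws, commutes with Borel maps `ℝ^ℕ → ℝ` and sends `F` on `F'`, that is, for each `n` the
random variables `Ψ(X)` with `X ∈ L⁰(F_n)` generate the complete σ-field `F'_n`.
Here `F_∞ = F_0` because `0` is the largest index. -/
def IsIsomorphic {Ω : Type u} {Ω' : Type v} [MeasurableSpace Ω] [MeasurableSpace Ω']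
    {P : Measure Ω} {P' : Measure Ω'} (F : NegFiltration P) (F' : NegFiltration P') : Prop :=
  ∃ Ψ : L0 (F 0) P ≃ L0 (F' 0) P',
    (∀ X : L0 (F 0) P, P'.map (Ψ X : Ω' →ₘ[P'] ℝ) = P.map (X : Ω →ₘ[P] ℝ)) ∧
    (∀ (f : (ℕ → ℝ) → ℝ), Measurable f → ∀ (X : ℕ → L0 (F 0) P) (Y : L0 (F 0) P),
      ((Y : Ω →ₘ[P] ℝ) =ᵐ[P] fun ω => f (fun i => (X i : Ω →ₘ[P] ℝ) ω)) →
      ((Ψ Y : Ω' →ₘ[P'] ℝ) =ᵐ[P'] fun ω => f (fun i => (Ψ (X i) : Ω' →ₘ[P'] ℝ) ω))) ∧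
    (∀ n : NonposInt, F' n = completion P'
      (⨆ X : {X : L0 (F 0) P // (X : Ω →ₘ[P] ℝ) ∈ L0 (F n) P},
        MeasurableSpace.comap ((Ψ X.1 : Ω' →ₘ[P'] ℝ) : Ω' → ℝ) Real.measurableSpace))

/-- `m₁` and `m₂` are independent conditionally on `m₀`. -/
def CondIndepFields {Ω : Type u} [MeasurableSpace Ω] (P : Measure Ω)
    (m₀ m₁ m₂ : MeasurableSpace Ω) : Prop :=
  ∀ A B : Set Ω, MeasurableSet[m₁] A → MeasurableSet[m₂] B →
    P⟦A ∩ B | m₀⟧ =ᵐ[P] P⟦A | m₀⟧ * P⟦B | m₀⟧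

/-- `F` is immersed into `G`. -/
def IsImmersed {Ω : Type u} [MeasurableSpace Ω] {P : Measure Ω} (F G : NegFiltration P) : Prop :=
  ∀ n : NonposInt, F n ≤ G n ∧ CondIndepFields P (F (pred n)) (F n) (G (pred n))

/-- `F` is immersible into `G'`. -/
def IsImmersible {Ω : Type u} {Ω' : Type v} [MeasurableSpace Ω] [MeasurableSpace Ω']
    {P : Measure Ω} {P' : Measure Ω'} (F : NegFiltration P) (G' : NegFiltration P') : Prop :=
  ∃ F' : NegFiltration P', IsIsomorphic F F' ∧ IsImmersed F' G'

/-- `F` is of product type: it is the (completed) natural filtration of a process `(V_n)_{n ≤ 0}` of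
independent random variables. The σ-fields being essentially separable, real-valued
random variables are enough. -/
def IsProductType {Ω : Type u} [MeasurableSpace Ω] {P : Measure Ω} (F : NegFiltration P) : Prop :=
  ∃ V : NonposInt → Ω → ℝ, (∀ n, Measurable (V n)) ∧ iIndepFun V P ∧
    ∀ n : NonposInt, F n = completion P
      (⨆ k : Set.Iic n, MeasurableSpace.comap (V k) Real.measurableSpace)

/-- `F` is standard: it is immersible into a product-type filtration on some probability space. -/
def IsStandard {Ω : Type u} [MeasurableSpace Ω] {P : Measure Ω} (F : NegFiltration P) : Prop :=
  ∃ (Ω' : Type u) (_ : MeasurableSpace Ω') (P' : Measure Ω') (_ : IsProbabilityMeasure P')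
    (H : NegFiltration P'), IsProductType H ∧ IsImmersible F H

/-- `F` is at the threshold of standardness: it is not standard, but every extracted filtration
`(F_{φ(n)})_{n ≤ 0}` such that `φ` skips infinitely many integers is standard. -/
def IsAtThreshold {Ω : Type u} [MeasurableSpace Ω] {P : Measure Ω} (F : NegFiltration P) : Prop :=
  ¬ IsStandard F ∧ ∀ (φ : NonposInt → NonposInt) (hφ : StrictMono φ),
    (Set.range φ)ᶜ.Infinite → IsStandard (F.extract φ hφ)

/-! Slowing down a filtration. -/

theorem le_self_of_strictMono {φ : NonposInt → NonposInt} (hφ : StrictMono φ) (k : NonposInt) :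
    φ k ≤ k := by
  obtain ⟨k, hk⟩ := k
  obtain ⟨j, rfl⟩ : ∃ j : ℕ, k = -(j : ℤ) := ⟨k.natAbs, by omega⟩
  induction j with
  | zero => exact (φ _).2
  | succ j ih =>
    have h1 := ih (by omega)
    have h2 : φ ⟨-((j + 1 : ℕ) : ℤ), hk⟩ < φ ⟨-(j : ℤ), by omega⟩ := hφ (by
      rw [Subtype.mk_lt_mk]; push_cast; omega)
    rw [← Subtype.coe_lt_coe] at h2
    rw [← Subtype.coe_le_coe] at h1 ⊢
    push_cast at h1 h2 ⊢
    omega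

/-- The indices `k ≤ 0` such that `n ≤ φ(k)`. -/
def slowSet (φ : NonposInt → NonposInt) (n : NonposInt) : Set ℤ :=
  {k : ℤ | ∃ h : k ≤ 0, n ≤ φ ⟨k, h⟩}

theorem slowSet_bddBelow {φ : NonposInt → NonposInt} (hφ : StrictMono φ) (n : NonposInt) :
    BddBelow (slowSet φ n) :=
  ⟨n, fun k ⟨h, hk⟩ => Subtype.coe_le_coe.2 (hk.trans (le_self_of_strictMono hφ ⟨k, h⟩))⟩

theorem zero_mem_slowSet {φ : NonposInt → NonposInt} (h0 : φ 0 = 0) (n : NonposInt) :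
    (0 : ℤ) ∈ slowSet φ n :=
  ⟨le_rfl, by
    have : φ ⟨0, le_rfl⟩ = 0 := h0
    rw [this]; exact n.2⟩

/-- The index `k` of the block containing `n`, namely the least `k` with `n ≤ φ(k)`, or equivalently
the only `k` such that `φ(k-1) + 1 ≤ n ≤ φ(k)`. -/
noncomputable def slowIndex (φ : NonposInt → NonposInt) (hφ : StrictMono φ) (h0 : φ 0 = 0)
    (n : NonposInt) : NonposInt :=
  ⟨sInf (slowSet φ n), csInf_le (slowSet_bddBelow hφ n) (zero_mem_slowSet h0 n)⟩

theorem slowIndex_mono {φ : NonposInt → NonposInt} (hφ : StrictMono φ) (h0 : φ 0 = 0) :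
    Monotone (slowIndex φ hφ h0) := fun n m hnm =>
  Subtype.coe_le_coe.1 (csInf_le_csInf (slowSet_bddBelow hφ n) ⟨0, zero_mem_slowSet h0 m⟩
    (fun _ ⟨h, hk⟩ => ⟨h, hnm.trans hk⟩))

theorem slowIndex_eq {φ : NonposInt → NonposInt} (hφ : StrictMono φ) (h0 : φ 0 = 0)
    (n k : NonposInt) (h1 : (φ (pred k) : ℤ) + 1 ≤ n) (h2 : (n : ℤ) ≤ φ k) :
    slowIndex φ hφ h0 n = k := by
  apply Subtype.ext
  apply le_antisymm
  · exact csInf_le (slowSet_bddBelow hφ n) ⟨k.2, h2⟩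
  · refine le_csInf ⟨0, zero_mem_slowSet h0 n⟩ ?_
    rintro j ⟨hj, hnj⟩
    by_contra! hlt
    have h3 : (⟨j, hj⟩ : NonposInt) ≤ pred k := by
      rw [← Subtype.coe_le_coe]; simp only [pred]; omega
    have h4 := hφ.monotone h3
    rw [← Subtype.coe_le_coe] at h4 hnj
    omega

/-- The slowed filtration: `G_n = F_k` if `φ(k-1) + 1 ≤ n ≤ φ(k)`. -/
noncomputable def NegFiltration.slow {Ω : Type u} [MeasurableSpace Ω] {P : Measure Ω}
    (F : NegFiltration P) (φ : NonposInt → NonposInt) (hφ : StrictMono φ) (h0 : φ 0 = 0) :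
    NegFiltration P where
  seq n := F (slowIndex φ hφ h0 n)
  mono' _ _ h := F.mono' (slowIndex_mono hφ h0 h)
  le' _ := F.le' _
  complete _ := F.complete _
  separable _ := F.separable _

theorem NegFiltration.slow_apply {Ω : Type u} [MeasurableSpace Ω] {P : Measure Ω}
    (F : NegFiltration P) (φ : NonposInt → NonposInt) (hφ : StrictMono φ) (h0 : φ 0 = 0)
    (n k : NonposInt) (h1 : (φ (pred k) : ℤ) + 1 ≤ n) (h2 : (n : ℤ) ≤ φ k) :
    F.slow φ hφ h0 n = F k :=
  congrArg F.seq (slowIndex_eq hφ h0 n k h1 h2)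

/-! The time change: `φ(0) = 0`, `φ(-1) = -1` and, for `k ≤ -1`, `φ(2k) = -2^{|k|}` and
`φ(2k-1) = -2^{|k|} - 1`. -/

/-- The values of the time change. -/
def interlinkVal (m : ℤ) : ℤ :=
  if m = 0 then 0
  else if m = -1 then -1
  else if Even m then -(2 : ℤ) ^ (m / 2).natAbs
  else -(2 : ℤ) ^ ((m + 1) / 2).natAbs - 1

theorem interlinkVal_even (k : ℤ) (hk : k ≤ -1) :
    interlinkVal (2 * k) = -(2 : ℤ) ^ k.natAbs := by
  have h : 2 * k / 2 = k := by omega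
  rw [interlinkVal, if_neg (by omega), if_neg (by omega), if_pos (even_two_mul k), h]

theorem interlinkVal_odd (k : ℤ) (hk : k ≤ -1) :
    interlinkVal (2 * k - 1) = -(2 : ℤ) ^ k.natAbs - 1 := by
  have h : (2 * k - 1 + 1) / 2 = k := by omega
  rw [interlinkVal, if_neg (by omega), if_neg (by omega),
    if_neg (by rw [Int.even_iff]; omega), h]

theorem interlinkVal_nonpos (m : ℤ) : interlinkVal m ≤ 0 := by
  have h1 : (0 : ℤ) < 2 ^ (m / 2).natAbs := by positivity
  have h2 : (0 : ℤ) < 2 ^ ((m + 1) / 2).natAbs := by positivity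
  unfold interlinkVal
  split_ifs <;> omega

/-- The time change. -/
def interlinkTime (m : NonposInt) : NonposInt := ⟨interlinkVal m, interlinkVal_nonpos m⟩

theorem interlinkTime_zero : interlinkTime 0 = 0 := rfl

theorem interlinkVal_pred_lt (m : ℤ) (hm : m ≤ 0) : interlinkVal (m - 1) < interlinkVal m := by
  rcases Int.even_or_odd' m with ⟨k, rfl | rfl⟩
  · rcases eq_or_lt_of_le (show k ≤ 0 by omega) with rfl | hk
    · decide
    · rw [interlinkVal_odd k (by omega), interlinkVal_even k (by omega)]; omega
  · rcases eq_or_lt_of_le (show k ≤ -1 by omega) with rfl | hk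
    · decide
    · have e1 : 2 * k + 1 - 1 = 2 * k := by ring
      have e2 : 2 * k + 1 = 2 * (k + 1) - 1 := by ring
      have e3 : k.natAbs = (k + 1).natAbs + 1 := by omega
      rw [e1, interlinkVal_even k (by omega), e2, interlinkVal_odd (k + 1) (by omega), e3, pow_succ]
      have h1 : (2 : ℤ) ^ 1 ≤ 2 ^ (k + 1).natAbs :=
        pow_le_pow_right₀ (by norm_num) (by omega)
      omega

theorem interlinkTime_strictMono : StrictMono interlinkTime := by
  have key : ∀ (j : ℕ) (m : ℤ), m ≤ 0 → interlinkVal (m - (j + 1)) < interlinkVal m := by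
    intro j
    induction j with
    | zero => intro m hm; simpa using interlinkVal_pred_lt m hm
    | succ j ih =>
      intro m hm
      have h1 := ih (m - 1) (by omega)
      have h2 := interlinkVal_pred_lt m hm
      have e : m - ((j + 1 : ℕ) + 1 : ℤ) = m - 1 - (j + 1) := by push_cast; ring
      rw [e]; omega
  intro a b hab
  rw [← Subtype.coe_lt_coe] at hab ⊢
  have h := key ((b : ℤ) - a - 1).toNat b b.2
  have e : (b : ℤ) - ((((b : ℤ) - a - 1).toNat : ℤ) + 1) = a := by omega
  rw [e] at h
  exact h

/-! The extracting maps `n ↦ 2^d n` and `n ↦ 2^d n - 2^{d-1}`. -/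

/-- `n ↦ 2^d n`. -/
def dyadicTime (d : ℕ) (n : NonposInt) : NonposInt :=
  ⟨2 ^ d * (n : ℤ), mul_nonpos_of_nonneg_of_nonpos (by positivity) n.2⟩

theorem dyadicTime_strictMono (d : ℕ) : StrictMono (dyadicTime d) := fun a b hab =>
  Subtype.coe_lt_coe.1 (mul_lt_mul_of_pos_left (Subtype.coe_lt_coe.2 hab) (by positivity))

/-- `n ↦ 2^d n - 2^{d-1}`, used for `d ≥ 1` only. -/
def shiftedDyadicTime (d : ℕ) (n : NonposInt) : NonposInt :=
  ⟨2 ^ d * (n : ℤ) - 2 ^ (d - 1), by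
    have h1 : (2 : ℤ) ^ d * (n : ℤ) ≤ 0 := mul_nonpos_of_nonneg_of_nonpos (by positivity) n.2
    have h2 : (0 : ℤ) < 2 ^ (d - 1) := by positivity
    omega⟩

theorem shiftedDyadicTime_strictMono (d : ℕ) : StrictMono (shiftedDyadicTime d) := fun a b hab =>
  Subtype.coe_lt_coe.1 (sub_lt_sub_right
    (mul_lt_mul_of_pos_left (Subtype.coe_lt_coe.2 hab) (by positivity)) _)

end Standardness

/-! Standardness is a property of the behaviour near minus infinity, and this is made precise by two
stability results.

The first, `IsStandard.comp`: if `F` is standard and `s` is non-decreasing and unbounded below, then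
`n ↦ F (s n)` is standard. The same `s` is applied to the isomorphic copy and to the product-type
filtration; the independent variables are regrouped in the disjoint blocks `(s(n-1), s(n)]`, and
immersion survives because by `isImmersed_iff` it compares each `F n` directly with `F 0`.

The second, `IsStandard.of_comp_pred`: if the filtration deprived of its last time is standard, so
is `F`. The last step is rebuilt over the product-type space from an independent uniform variable,
through the conditional law of a generator of `F 0` given the past; the uniform variable is appended
to the product-type filtration. Both results use `IsIsomorphic.exists_generators` and
`isIsomorphic_of_generators`, which turn an isomorphism into an equality of laws of sequences of
real generators.

The rest is arithmetic. The even index `2k` labels the single time `-2^|k|`, together with no other;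
the odd index `-2N-1` labels the times strictly between `-2^(N+1)` and `-2^N`. Multiples of `2^d`
meet every block far enough in the past, so a standard extraction along them would make `F`
standard. For `n < 0` the times `2^d n - 2^(d-1)` are odd multiples of `2^(d-1)` that are never
minus a power of two, so only odd indices occur: infinitely many indices are omitted, and the
threshold hypothesis applies. -/

namespace Standardness

/-! ### Completed σ-fields and their real generators -/

section Completion

variable {Ω : Type*} {m m₁ m₂ : MeasurableSpace Ω} [mΩ : MeasurableSpace Ω] {P : Measure Ω}

theorem measurableSet_completion {s : Set Ω} :
    MeasurableSet[completion P m] s ↔ ∃ t, MeasurableSet[m] t ∧ s =ᵐ[P] t := Iff.rfl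

theorem le_completion : m ≤ completion P m :=
  fun _ hs => measurableSet_completion.2 ⟨_, hs, ae_eq_refl _⟩

theorem completion_le_completion (h : m₁ ≤ completion P m₂) :
    completion P m₁ ≤ completion P m₂ := by
  rintro s ⟨t, ht, hst⟩
  obtain ⟨r, hr, htr⟩ := h t ht
  exact ⟨r, hr, hst.trans htr⟩

theorem completion_mono (h : m₁ ≤ m₂) :
    completion P m₁ ≤ completion P m₂ :=
  completion_le_completion (h.trans le_completion)

theorem measurableSet_of_ae_eq (hc : ∀ s : Set Ω, P s = 0 → MeasurableSet[m] s)
    {s t : Set Ω} (ht : MeasurableSet[m] t)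
    (h : s =ᵐ[P] t) : MeasurableSet[m] s := by
  have h1 := hc _ (ae_eq_set.1 h).1
  have h2 := hc _ (ae_eq_set.1 h).2
  have : s = (t \ (t \ s)) ∪ (s \ t) := by ext x; simp; tauto
  rw [this]
  exact (ht.diff h2).union h1

theorem completion_le_of_complete (hc : ∀ s : Set Ω, P s = 0 → MeasurableSet[m] s) (h : m₁ ≤ m) :
    completion P m₁ ≤ m := by
  rintro s ⟨t, ht, hst⟩
  exact measurableSet_of_ae_eq hc (h t ht) hst

theorem NegFiltration.complete_space (F : NegFiltration P) (s : Set Ω) (hs : P s = 0) :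
    MeasurableSet s := F.le' 0 s (F.complete 0 s hs)

theorem measurableSet_completion_of_null {s : Set Ω} (hs : P s = 0) :
    MeasurableSet[completion P m] s :=
  ⟨∅, MeasurableSpace.measurableSet_empty m, ae_eq_empty.2 hs⟩

theorem comap_le_completion_comap {α β : Type*} [mα : MeasurableSpace α] [mβ : MeasurableSpace β]
    {f : Ω → α} {g : Ω → β} {h : β → α} (hh : Measurable h) (e : f =ᵐ[P] h ∘ g) :
    MeasurableSpace.comap f mα ≤ completion P (MeasurableSpace.comap g mβ) := by
  rintro _ ⟨s, hs, rfl⟩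
  refine ⟨g ⁻¹' (h ⁻¹' s), ⟨_, hh hs, rfl⟩, ?_⟩
  filter_upwards [e] with ω hω
  exact propext (by change f ω ∈ s ↔ h (g ω) ∈ s; rw [hω]; rfl)

theorem condExp_completion [IsFiniteMeasure P]
    (hm : completion P m ≤ mΩ) {f : Ω → ℝ} (hf : Integrable f P) :
    P[f | completion P m] =ᵐ[P] P[f | m] := by
  have hm' : m ≤ mΩ := le_completion.trans hm
  symm
  refine ae_eq_condExp_of_forall_setIntegral_eq hm hf
    (fun _ _ _ => integrable_condExp.integrableOn) ?_ ?_
  · rintro s ⟨t, ht, hst⟩ -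
    rw [setIntegral_congr_set hst, setIntegral_condExp hm' hf ht, setIntegral_congr_set hst]
  · exact (stronglyMeasurable_condExp.mono le_completion).aestronglyMeasurable

/-- Doob–Dynkin factorisation up to null sets: a version measurable for the uncompleted σ-field is
supplied by the conditional expectation. -/
theorem exists_measurable_comp_of_completion [IsFiniteMeasure P] {β : Type*}
    [mβ : MeasurableSpace β] {g : Ω → β}
    (hm : completion P (MeasurableSpace.comap g mβ) ≤ mΩ) {f : Ω → ℝ}
    (hf : Measurable[completion P (MeasurableSpace.comap g mβ)] f) :
    ∃ h : β → ℝ, Measurable h ∧ f =ᵐ[P] h ∘ g := by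
  -- `f` need not be integrable; `arctan` makes it bounded and `tan` undoes this at the end.
  set X : Ω → ℝ := fun ω => Real.arctan (f ω) with hX
  have hXm : Measurable[completion P (MeasurableSpace.comap g mβ)] X :=
    Real.measurable_arctan.comp hf
  have hXi : Integrable X P := by
    refine Integrable.of_bound (hXm.mono hm le_rfl).aestronglyMeasurable (Real.pi / 2)
      (ae_of_all _ fun ω => ?_)
    exact abs_le.2 ⟨(Real.neg_pi_div_two_lt_arctan _).le, (Real.arctan_lt_pi_div_two _).le⟩
  have e1 := condExp_completion hm hXi
  rw [condExp_of_stronglyMeasurable hm hXm.stronglyMeasurable hXi] at e1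
  obtain ⟨h, hh, hhe⟩ := Measurable.exists_eq_measurable_comp
    (stronglyMeasurable_condExp (f := X) (μ := P) (m := MeasurableSpace.comap g mβ)).measurable
  have htan : Measurable Real.tan := by
    have : Real.tan = fun x => Real.sin x / Real.cos x := funext Real.tan_eq_sin_div_cos
    rw [this]
    exact Real.measurable_sin.div Real.measurable_cos
  refine ⟨fun b => Real.tan (h b), htan.comp hh, ?_⟩
  filter_upwards [e1] with ω hω
  rw [hhe] at hω
  simp only [hX, Function.comp_apply] at hω ⊢
  rw [← hω, Real.tan_arctan]

/-- `Z` generates `n` as a complete σ-field. -/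
def Generates {β : Type*} [mβ : MeasurableSpace β] (P : Measure Ω) (Z : Ω → β)
    (n : MeasurableSpace Ω) : Prop :=
  n = @completion Ω mΩ P (MeasurableSpace.comap Z mβ)

/-- The indicators of the `e n` form a point of `ℕ → Prop`, a standard Borel space, which embeds
measurably in `ℝ`. -/
theorem exists_generator (e : ℕ → Set Ω)
    (he : m = completion P (MeasurableSpace.generateFrom (Set.range e))) :
    ∃ Z : Ω → ℝ, Generates P Z m := by
  let Y : Ω → (ℕ → Prop) := fun ω n => ω ∈ e n
  have hE := measurableEmbedding_embeddingReal (ℕ → Prop)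
  refine ⟨embeddingReal (ℕ → Prop) ∘ Y, ?_⟩
  rw [Generates, he, ← MeasurableSpace.comap_comp, hE.comap_eq]
  congr 1
  apply le_antisymm
  · refine MeasurableSpace.generateFrom_le ?_
    rintro _ ⟨n, rfl⟩
    refine ⟨{p | p n}, ?_, rfl⟩
    exact measurableSet_setOfPred.2 (measurable_pi_apply n)
  · refine Measurable.comap_le ?_
    refine @measurable_pi_lambda _ _ _ (MeasurableSpace.generateFrom (Set.range e)) _ _ fun n => ?_
    exact (@measurableSet_setOfPred _ (MeasurableSpace.generateFrom (Set.range e)) _).1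
      (MeasurableSpace.measurableSet_generateFrom ⟨n, rfl⟩)

theorem mem_L0_iff [IsFiniteMeasure P] {β : Type*} [mβ : MeasurableSpace β] {Z : Ω → β}
    (hm : m ≤ mΩ) (hZ : Generates P Z m) {X : Ω →ₘ[P] ℝ} :
    X ∈ L0 m P ↔ ∃ h : β → ℝ, Measurable h ∧ X =ᵐ[P] h ∘ Z := by
  rw [Generates] at hZ
  subst hZ
  constructor
  · rintro ⟨Y, hY, hXY⟩
    obtain ⟨h, hh, e⟩ := exists_measurable_comp_of_completion hm hY.measurable
    exact ⟨h, hh, hXY.trans e⟩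
  · rintro ⟨h, hh, e⟩
    exact ⟨h ∘ Z, ((hh.comp (comap_measurable Z)).mono le_completion le_rfl).stronglyMeasurable,
      e⟩

theorem Generates.measurable {β : Type*} [mβ : MeasurableSpace β] {Z : Ω → β}
    (hZ : Generates P Z m) : Measurable[m] Z := by
  rw [Generates] at hZ
  rw [hZ]
  exact (comap_measurable Z).mono le_completion le_rfl

end Completion

/-! ### Isomorphisms as equalities of laws of generators -/

section Isomorphism

variable {Ω : Type u} {Ω' : Type v} [mΩ : MeasurableSpace Ω] [mΩ' : MeasurableSpace Ω']
  {P : Measure Ω} {P' : Measure Ω'}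

theorem NegFiltration.measurable_of_generates (F : NegFiltration P) {n : NonposInt} {Z : Ω → ℝ}
    (hZ : Generates P Z (F n)) : Measurable Z :=
  hZ.measurable.mono (F.le' n) le_rfl

theorem NegFiltration.exists_generators (F : NegFiltration P) :
    ∃ Z : NonposInt → Ω → ℝ, ∀ n, Generates P (Z n) (F n) := by
  choose e he using F.separable
  choose Z hZ using fun n => exists_generator (e n) (he n)
  exact ⟨Z, hZ⟩

theorem NonposInt.le_zero (n : NonposInt) : n ≤ 0 := n.2

theorem ae_transfer {α : Type*} [MeasurableSpace α] {Z : Ω → α} {Z' : Ω' → α} (hZ : Measurable Z)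
    (hZ' : Measurable Z') (h : P.map Z = P'.map Z') {s : Set α} (hs : MeasurableSet s)
    (hP : ∀ᵐ ω ∂P, Z ω ∈ s) : ∀ᵐ ω ∂P', Z' ω ∈ s := by
  have h1 : ∀ᵐ z ∂(P.map Z), z ∈ s := (ae_map_iff hZ.aemeasurable hs).2 hP
  rw [h] at h1
  exact (ae_map_iff hZ'.aemeasurable hs).1 h1

theorem map_embedding_injective {α β : Type*} [MeasurableSpace α] [MeasurableSpace β]
    {f : α → β} (hf : MeasurableEmbedding f) {μ ν : Measure α} (h : μ.map f = ν.map f) : μ = ν := by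
  rw [← hf.comap_map μ, h, hf.comap_map]

theorem mk_mem_L0 (F : NegFiltration P) {n : NonposInt} {f : Ω → ℝ} (hf : Measurable[F n] f) :
    AEEqFun.mk f (hf.mono (F.le' n) le_rfl).aestronglyMeasurable ∈ L0 (F n) P :=
  ⟨f, hf.stronglyMeasurable, AEEqFun.coeFn_mk _ _⟩

/-- The images under `Ψ` of generators of `F` are generators of `F'`, because `Ψ` commutes with
Borel maps. -/
theorem IsIsomorphic.exists_generators [IsProbabilityMeasure P] [IsProbabilityMeasure P']
    {F : NegFiltration P} {F' : NegFiltration P'} (h : IsIsomorphic F F') :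
    ∃ (Z : NonposInt → Ω → ℝ) (Z' : NonposInt → Ω' → ℝ),
      (∀ n, Generates P (Z n) (F n)) ∧ (∀ n, Generates P' (Z' n) (F' n)) ∧
      P.map (fun ω n => Z n ω) = P'.map (fun ω n => Z' n ω) := by
  obtain ⟨Ψ, hlaw, hcomm, hgen⟩ := h
  obtain ⟨Z, hZ⟩ := F.exists_generators
  have hZ0 : ∀ n, Measurable[F 0] (Z n) := fun n =>
    (hZ n).measurable.mono (F.mono' (NonposInt.le_zero n)) le_rfl
  let X : NonposInt → L0 (F 0) P := fun n => ⟨_, mk_mem_L0 F (hZ0 n)⟩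
  have hX : ∀ n, (X n : Ω →ₘ[P] ℝ) =ᵐ[P] Z n := fun n => AEEqFun.coeFn_mk _ _
  let Z' : NonposInt → Ω' → ℝ := fun n => (Ψ (X n) : Ω' →ₘ[P'] ℝ)
  have hZm : Measurable (fun ω n => Z n ω) :=
    measurable_pi_lambda _ fun n => F.measurable_of_generates (hZ n)
  have hZm' : Measurable (fun ω n => Z' n ω) :=
    measurable_pi_lambda _ fun n => (AEEqFun.stronglyMeasurable _).measurable
  refine ⟨Z, Z', hZ, fun n => ?_, ?_⟩
  · rw [Generates, hgen n]
    apply le_antisymm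
    · refine completion_le_completion (iSup_le fun Y => ?_)
      obtain ⟨g, hg, hYg⟩ := (mem_L0_iff (F.le' n) (hZ n)).1 Y.2
      refine comap_le_completion_comap hg
        (hcomm (fun x => g (x 0)) (hg.comp (measurable_pi_apply 0)) (fun _ => X n) Y.1 ?_)
      filter_upwards [hYg, hX n] with ω h1 h2
      rw [h1, h2]; rfl
    · exact completion_mono (le_iSup (fun Y : {Y : L0 (F 0) P // (Y : Ω →ₘ[P] ℝ) ∈ L0 (F n) P} =>
        MeasurableSpace.comap ((Ψ Y.1 : Ω' →ₘ[P'] ℝ) : Ω' → ℝ) Real.measurableSpace)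
        ⟨X n, mk_mem_L0 F (hZ n).measurable⟩)
  · have hE := measurableEmbedding_embeddingReal (NonposInt → ℝ)
    -- `Ψ` preserves laws of single variables only, so the whole sequence is coded as one real
    -- variable, a Borel function of countably many coordinates.
    refine map_embedding_injective hE ?_
    let f : (ℕ → ℝ) → ℝ := fun x => embeddingReal (NonposInt → ℝ) fun n => x (n : ℤ).natAbs
    have hf : Measurable f := hE.measurable.comp
      (measurable_pi_lambda _ fun n => measurable_pi_apply _)
    let idx : ℕ → NonposInt := fun i => ⟨-(i : ℤ), by omega⟩
    have hidx : ∀ n : NonposInt, idx (n : ℤ).natAbs = n := fun n =>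
      Subtype.ext (by have := n.2; simp only [idx]; omega)
    have hY0 : Measurable[F 0] (fun ω => f fun i => Z (idx i) ω) :=
      hf.comp (@measurable_pi_lambda _ _ _ (F 0) _ _ fun i => hZ0 _)
    let Y : L0 (F 0) P := ⟨_, mk_mem_L0 F hY0⟩
    have hY : (Y : Ω →ₘ[P] ℝ) =ᵐ[P] fun ω => f fun i => Z (idx i) ω := AEEqFun.coeFn_mk _ _
    have h1 : (Ψ Y : Ω' →ₘ[P'] ℝ) =ᵐ[P'] fun ω => f fun i => Z' (idx i) ω := by
      refine hcomm f hf (fun i => X (idx i)) Y ?_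
      filter_upwards [hY, ae_all_iff.2 fun i => hX (idx i)] with ω h1 h2
      rw [h1]; simp only [h2]
    have h2 := hlaw Y
    rw [Measure.map_congr h1, Measure.map_congr hY] at h2
    rw [Measure.map_map hE.measurable hZm, Measure.map_map hE.measurable hZm']
    simp only [f, hidx] at h2
    exact h2.symm

/-- Identifies `L⁰(F n)` with `L⁰` of the law of a generator; two filtrations whose generators have
the same law are then compared through this common model. -/
theorem NegFiltration.exists_L0_equiv_map [IsFiniteMeasure P] (F : NegFiltration P)
    {n : NonposInt} {Z : Ω → ℝ} (hZ : Generates P Z (F n)) {μ : Measure ℝ}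
    (hp : MeasurePreserving Z P μ) :
    ∃ Φ : (ℝ →ₘ[μ] ℝ) ≃ L0 (F n) P, ∀ g, (Φ g : Ω →ₘ[P] ℝ) =ᵐ[P] g ∘ Z := by
  refine ⟨Equiv.ofBijective (fun g => ⟨g.compMeasurePreserving Z hp,
    (mem_L0_iff (F.le' n) hZ).2 ⟨g, (AEEqFun.stronglyMeasurable g).measurable,
      AEEqFun.coeFn_compMeasurePreserving g hp⟩⟩) ⟨?_, ?_⟩,
      fun g => AEEqFun.coeFn_compMeasurePreserving g hp⟩
  · intro g g' h
    have h1 := congrArg Subtype.val h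
    dsimp only at h1
    have h2 : (g : ℝ → ℝ) ∘ Z =ᵐ[P] g' ∘ Z :=
      (AEEqFun.coeFn_compMeasurePreserving g hp).symm.trans
        (h1 ▸ AEEqFun.coeFn_compMeasurePreserving g' hp)
    refine AEEqFun.ext ?_
    have h3 := (ae_map_iff hp.measurable.aemeasurable
      (measurableSet_eq_fun (AEEqFun.stronglyMeasurable g).measurable
        (AEEqFun.stronglyMeasurable g').measurable)).2 h2
    rwa [hp.map_eq] at h3
  · intro X
    obtain ⟨h, hh, e⟩ := (mem_L0_iff (F.le' n) hZ).1 X.2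
    refine ⟨AEEqFun.mk h hh.aestronglyMeasurable, Subtype.ext (AEEqFun.ext ?_)⟩
    refine Filter.EventuallyEq.trans (f := _)
      (AEEqFun.coeFn_compMeasurePreserving (AEEqFun.mk h hh.aestronglyMeasurable) hp)
      (Filter.EventuallyEq.trans ?_ e.symm)
    exact hp.quasiMeasurePreserving.ae_eq_comp (AEEqFun.coeFn_mk _ _)

theorem exists_L0_equiv [IsFiniteMeasure P] [IsFiniteMeasure P']
    (F : NegFiltration P) (F' : NegFiltration P') {n : NonposInt} {Z : Ω → ℝ} {Z' : Ω' → ℝ}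
    (hZ : Generates P Z (F n)) (hZ' : Generates P' Z' (F' n)) (h : P.map Z = P'.map Z') :
    ∃ Ψ : L0 (F n) P ≃ L0 (F' n) P', ∀ (X : L0 (F n) P) (g : ℝ → ℝ), Measurable g →
      (X : Ω →ₘ[P] ℝ) =ᵐ[P] g ∘ Z → (Ψ X : Ω' →ₘ[P'] ℝ) =ᵐ[P'] g ∘ Z' := by
  have hp : MeasurePreserving Z P (P.map Z) := ⟨F.measurable_of_generates hZ, rfl⟩
  have hp' : MeasurePreserving Z' P' (P.map Z) := ⟨F'.measurable_of_generates hZ', h.symm⟩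
  obtain ⟨Φ, hΦ⟩ := F.exists_L0_equiv_map hZ hp
  obtain ⟨Φ', hΦ'⟩ := F'.exists_L0_equiv_map hZ' hp'
  refine ⟨Φ.symm.trans Φ', fun X g hg hX => ?_⟩
  have h1 : Φ (AEEqFun.mk g hg.aestronglyMeasurable) = X := by
    refine Subtype.ext (AEEqFun.ext ((hΦ _).trans (Filter.EventuallyEq.trans ?_ hX.symm)))
    exact hp.quasiMeasurePreserving.ae_eq_comp (AEEqFun.coeFn_mk _ _)
  rw [← h1, Equiv.trans_apply, Equiv.symm_apply_apply]
  exact (hΦ' _).trans (hp'.quasiMeasurePreserving.ae_eq_comp (AEEqFun.coeFn_mk _ _))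

theorem isIsomorphic_of_generators [IsProbabilityMeasure P] [IsProbabilityMeasure P']
    {F : NegFiltration P} {F' : NegFiltration P'} {Z : NonposInt → Ω → ℝ} {Z' : NonposInt → Ω' → ℝ}
    (hZ : ∀ n, Generates P (Z n) (F n)) (hZ' : ∀ n, Generates P' (Z' n) (F' n))
    (h : P.map (fun ω n => Z n ω) = P'.map (fun ω n => Z' n ω)) : IsIsomorphic F F' := by
  have mZ := fun n => F.measurable_of_generates (hZ n)
  have mZ' := fun n => F'.measurable_of_generates (hZ' n)
  have h0 : P.map (Z 0) = P'.map (Z' 0) := by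
    have := congrArg (Measure.map fun z => z 0) h
    rwa [Measure.map_map (measurable_pi_apply _) (measurable_pi_lambda _ mZ),
      Measure.map_map (measurable_pi_apply _) (measurable_pi_lambda _ mZ')] at this
  obtain ⟨Ψ, hΨ⟩ := exists_L0_equiv F F' (hZ 0) (hZ' 0) h0
  have hex : ∀ X : L0 (F 0) P, ∃ g : ℝ → ℝ, Measurable g ∧ (X : Ω →ₘ[P] ℝ) =ᵐ[P] g ∘ Z 0 :=
    fun X => (mem_L0_iff (F.le' 0) (hZ 0)).1 X.2
  -- The relation `Z n = k (Z 0)` is an event of the joint law, so the same `k` serves on both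
  -- spaces.
  have hcoord : ∀ n, ∃ k : ℝ → ℝ, Measurable k ∧ Z n =ᵐ[P] k ∘ Z 0 ∧ Z' n =ᵐ[P'] k ∘ Z' 0 := by
    intro n
    have h1 : Measurable[completion P (MeasurableSpace.comap (Z 0) Real.measurableSpace)] (Z n) := by
      have := (hZ n).measurable.mono (F.mono' (NonposInt.le_zero n)) le_rfl
      rwa [show F.seq 0 = _ from hZ 0] at this
    obtain ⟨k, hk, e⟩ := exists_measurable_comp_of_completion
      (by have := F.le' 0; rwa [show F.seq 0 = _ from hZ 0] at this) h1
    refine ⟨k, hk, e, ?_⟩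
    exact ae_transfer (measurable_pi_lambda _ mZ) (measurable_pi_lambda _ mZ') h
      (s := {z | z n = k (z 0)})
      (measurableSet_eq_fun (measurable_pi_apply _) (hk.comp (measurable_pi_apply _))) e
  refine ⟨Ψ, fun X => ?_, fun f hf X Y hY => ?_, fun n => ?_⟩
  · obtain ⟨g, hg, e⟩ := hex X
    rw [Measure.map_congr e, Measure.map_congr (hΨ X g hg e), ← Measure.map_map hg (mZ 0), h0,
      Measure.map_map hg (mZ' 0)]
  · choose g hg e using fun i => hex (X i)
    have h1 := hΨ Y (fun x => f fun i => g i x) (hf.comp (measurable_pi_lambda _ hg)) (by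
      filter_upwards [hY, ae_all_iff.2 e] with ω h1 h2
      rw [h1]; simp only [h2]; rfl)
    filter_upwards [h1, ae_all_iff.2 fun i => hΨ _ _ (hg i) (e i)] with ω h1 h2
    rw [h1]; simp only [h2]; rfl
  · obtain ⟨k, hk, e, e'⟩ := hcoord n
    rw [show F' n = _ from hZ' n]
    have key : ∀ (X : L0 (F 0) P) (g : ℝ → ℝ), Measurable g →
        (X : Ω →ₘ[P] ℝ) =ᵐ[P] g ∘ Z n → (Ψ X : Ω' →ₘ[P'] ℝ) =ᵐ[P'] g ∘ Z' n := by
      intro X g hg hX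
      have h1 := hΨ X (g ∘ k) (hg.comp hk) (hX.trans (e.fun_comp g))
      exact h1.trans (e'.fun_comp g).symm
    apply le_antisymm
    · have hm : Measurable[F 0] (Z n) :=
        (hZ n).measurable.mono (F.mono' (NonposInt.le_zero n)) le_rfl
      refine completion_le_completion ?_
      let X : {X : L0 (F 0) P // (X : Ω →ₘ[P] ℝ) ∈ L0 (F n) P} :=
        ⟨⟨_, mk_mem_L0 F hm⟩, mk_mem_L0 F (hZ n).measurable⟩
      have h1 := key X.1 id measurable_id (AEEqFun.coeFn_mk _ _)
      refine (comap_le_completion_comap measurable_id h1.symm).trans (completion_mono ?_)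
      exact le_iSup (fun Y : {Y : L0 (F 0) P // (Y : Ω →ₘ[P] ℝ) ∈ L0 (F n) P} =>
        MeasurableSpace.comap ((Ψ Y.1 : Ω' →ₘ[P'] ℝ) : Ω' → ℝ) Real.measurableSpace) X
    · refine completion_le_completion (iSup_le fun Y => ?_)
      obtain ⟨g, hg, hYg⟩ := (mem_L0_iff (F.le' n) (hZ n)).1 Y.2
      exact comap_le_completion_comap hg (key _ g hg hYg)

end Isomorphism

/-! ### Conditional independence through conditional expectations -/

section ConditionalIndependence

theorem indicator_mul_eq {Ω : Type*} (A : Set Ω) (f : Ω → ℝ) :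
    (A.indicator fun _ => (1 : ℝ)) * f = A.indicator f := by
  ext ω
  by_cases h : ω ∈ A <;> simp [h]

theorem sup_eq_generateFrom_inter {Ω : Type*} {m₁ m₂ : MeasurableSpace Ω} :
    m₁ ⊔ m₂ = MeasurableSpace.generateFrom
      {s | ∃ A C, MeasurableSet[m₁] A ∧ MeasurableSet[m₂] C ∧ s = A ∩ C} := by
  apply le_antisymm
  · refine sup_le (fun A hA => ?_) (fun C hC => ?_)
    · exact MeasurableSpace.measurableSet_generateFrom
        ⟨A, Set.univ, hA, @MeasurableSet.univ _ m₂, (Set.inter_univ A).symm⟩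
    · exact MeasurableSpace.measurableSet_generateFrom
        ⟨Set.univ, C, @MeasurableSet.univ _ m₁, hC, (Set.univ_inter C).symm⟩
  · refine MeasurableSpace.generateFrom_le ?_
    rintro _ ⟨A, C, hA, hC, rfl⟩
    exact @MeasurableSet.inter _ (m₁ ⊔ m₂) _ _ (le_sup_left (a := m₁) _ hA)
      (le_sup_right (a := m₁) _ hC)

variable {Ω : Type*} {m m₀ m₁ m₂ : MeasurableSpace Ω} [mΩ : MeasurableSpace Ω] {P : Measure Ω}

theorem condExp_indicator_congr {A B : Set Ω} (h : A =ᵐ[P] B) : P⟦A | m⟧ =ᵐ[P] P⟦B | m⟧ :=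
  condExp_congr_ae (indicator_ae_eq_of_ae_eq_set h)

variable [IsProbabilityMeasure P]

theorem integrable_indicator_one {B : Set Ω} (hB : MeasurableSet B) :
    Integrable (B.indicator fun _ => (1 : ℝ)) P :=
  (integrable_const 1).indicator hB

theorem condExp_indicator_mul {A B : Set Ω} (hA : MeasurableSet A) :
    P[A.indicator (P⟦B | m⟧) | m] =ᵐ[P] P⟦A | m⟧ * P⟦B | m⟧ := by
  rw [← indicator_mul_eq]
  refine condExp_mul_of_stronglyMeasurable_right stronglyMeasurable_condExp ?_
    (integrable_indicator_one hA)
  rw [indicator_mul_eq]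
  exact integrable_condExp.indicator hA

/-- When `m₀ ≤ m₁`, conditional independence means that `m₁` predicts `m₂` no better than `m₀`. One
direction integrates over sets of `m₁`, the other conditions twice. -/
theorem condIndepFields_iff (h01 : m₀ ≤ m₁) (h1 : m₁ ≤ mΩ) (h2 : m₂ ≤ mΩ) :
    CondIndepFields P m₀ m₁ m₂ ↔
      ∀ B, MeasurableSet[m₂] B → P⟦B | m₁⟧ =ᵐ[P] P⟦B | m₀⟧ := by
  have h0 := h01.trans h1
  constructor
  · intro h B hB
    symm
    refine ae_eq_condExp_of_forall_setIntegral_eq h1 (integrable_indicator_one (h2 _ hB))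
      (fun _ _ _ => integrable_condExp.integrableOn) (fun A hA _ => ?_)
      (stronglyMeasurable_condExp.mono h01).aestronglyMeasurable
    calc ∫ ω in A, (P⟦B | m₀⟧) ω ∂P = ∫ ω, (A.indicator (P⟦B | m₀⟧)) ω ∂P :=
          (integral_indicator (h1 _ hA)).symm
      _ = ∫ ω, (P[A.indicator (P⟦B | m₀⟧) | m₀]) ω ∂P := (integral_condExp h0).symm
      _ = ∫ ω, (P⟦A ∩ B | m₀⟧) ω ∂P :=
          integral_congr_ae ((condExp_indicator_mul (h1 _ hA)).trans (h A B hA hB).symm)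
      _ = ∫ ω, ((A ∩ B).indicator fun _ => (1 : ℝ)) ω ∂P := integral_condExp h0
      _ = ∫ ω in A, (B.indicator fun _ => (1 : ℝ)) ω ∂P := by
          rw [← Set.indicator_indicator, integral_indicator (h1 _ hA)]
  · intro h A B hA hB
    have e1 : P[(A ∩ B).indicator (fun _ => (1 : ℝ)) | m₁] =ᵐ[P] A.indicator (P⟦B | m₀⟧) := by
      rw [← Set.indicator_indicator]
      refine (condExp_indicator (integrable_indicator_one (h2 _ hB)) hA).trans ?_
      filter_upwards [h B hB] with ω hω
      by_cases hωA : ω ∈ A <;> simp [hωA, hω]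
    exact (condExp_condExp_of_le h01 h1).symm.trans
      ((condExp_congr_ae e1).trans (condExp_indicator_mul (h1 _ hA)))

theorem condExp_eq_of_le_of_le (h01 : m₀ ≤ m₁) (h12 : m₁ ≤ m₂) (h2 : m₂ ≤ mΩ) {f : Ω → ℝ}
    (h : P[f | m₂] =ᵐ[P] P[f | m₀]) : P[f | m₁] =ᵐ[P] P[f | m₀] := by
  refine (condExp_condExp_of_le h12 h2).symm.trans ((condExp_congr_ae h).trans ?_)
  rw [condExp_of_stronglyMeasurable (h12.trans h2) (stronglyMeasurable_condExp.mono h01)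
    integrable_condExp]

theorem setIntegral_inter_of_indep {A C : Set Ω} (h1 : m₁ ≤ mΩ) (h2 : m₂ ≤ mΩ)
    (h : Indep m₁ m₂ P) {f : Ω → ℝ} (hf : StronglyMeasurable[m₁] f) (hfi : Integrable f P)
    (hA : MeasurableSet[m₁] A) (hC : MeasurableSet[m₂] C) :
    ∫ ω in A ∩ C, f ω ∂P = P.real C * ∫ ω in A, f ω ∂P := by
  have e := condExp_indep_eq h1 h2 (hf.indicator hA) h
  rw [Set.inter_comm, ← setIntegral_indicator (h1 _ hA),
    ← setIntegral_condExp h2 (hfi.indicator (h1 _ hA)) hC,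
    setIntegral_congr_ae (h2 _ hC) (e.mono fun _ hx _ => hx), setIntegral_const,
    integral_indicator (h1 _ hA), smul_eq_mul]

/-- Information independent of `m₁` does not help to predict an event of `m₁`. The integrals are
compared on the π-system of intersections `A ∩ C`, where independence factors out `P.real C`. -/
theorem condExp_sup_of_indep (h01 : m₀ ≤ m₁) (h1 : m₁ ≤ mΩ) (h2 : m₂ ≤ mΩ)
    (h : Indep m₁ m₂ P) {B : Set Ω} (hB : MeasurableSet[m₁] B) :
    P⟦B | m₀ ⊔ m₂⟧ =ᵐ[P] P⟦B | m₀⟧ := by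
  have h0 := h01.trans h1
  have hle : m₀ ⊔ m₂ ≤ mΩ := sup_le h0 h2
  have hBi : Integrable (B.indicator fun _ => (1 : ℝ)) P := integrable_indicator_one (h1 _ hB)
  have hBs : StronglyMeasurable[m₁] (B.indicator fun _ => (1 : ℝ)) :=
    stronglyMeasurable_const.indicator hB
  symm
  refine ae_eq_condExp_of_forall_setIntegral_eq hle hBi
    (fun _ _ _ => integrable_condExp.integrableOn) (fun s hs _ => ?_)
    (stronglyMeasurable_condExp.mono (le_sup_left : m₀ ≤ m₀ ⊔ m₂)).aestronglyMeasurable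
  induction s, hs using MeasurableSpace.induction_on_inter sup_eq_generateFrom_inter with
  | h_inter =>
    rintro _ ⟨A, C, hA, hC, rfl⟩ _ ⟨A', C', hA', hC', rfl⟩ -
    exact ⟨A ∩ A', C ∩ C', hA.inter hA', hC.inter hC', Set.inter_inter_inter_comm _ _ _ _⟩
  | empty => simp
  | basic t ht =>
    obtain ⟨A, C, hA, hC, rfl⟩ := ht
    rw [setIntegral_inter_of_indep h1 h2 h (stronglyMeasurable_condExp.mono h01)
        integrable_condExp (h01 _ hA) hC,
      setIntegral_inter_of_indep h1 h2 h hBs hBi (h01 _ hA) hC, setIntegral_condExp h0 hBi hA]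
  | compl t htm ih =>
    rw [setIntegral_compl (hle _ htm) integrable_condExp, setIntegral_compl (hle _ htm) hBi,
      ih (measure_lt_top _ _), integral_condExp h0]
  | iUnion f hd hfm ih =>
    rw [integral_iUnion (fun i => hle _ (hfm i)) hd integrable_condExp.integrableOn,
      integral_iUnion (fun i => hle _ (hfm i)) hd hBi.integrableOn]
    exact tsum_congr fun i => ih i (measure_lt_top _ _)

end ConditionalIndependence

/-! ### Conditional expectations pulled back to an extension -/

section Pullback

variable {Ω : Type*} {Ω' : Type*} {m : MeasurableSpace Ω} [mΩ : MeasurableSpace Ω]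
  [mΩ' : MeasurableSpace Ω'] {P : Measure Ω} {P' : Measure Ω'} {π : Ω' → Ω}

theorem condExp_comap [IsFiniteMeasure P] [IsFiniteMeasure P'] (hπ : MeasurePreserving π P' P)
    (hm : m ≤ mΩ) {f : Ω → ℝ} (hf : Integrable f P) :
    P'[f ∘ π | m.comap π] =ᵐ[P'] P[f | m] ∘ π := by
  have hle : m.comap π ≤ mΩ' :=
    (MeasurableSpace.comap_mono hm).trans hπ.measurable.comap_le
  symm
  refine ae_eq_condExp_of_forall_setIntegral_eq hle (hπ.integrable_comp_of_integrable hf)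
    (fun _ _ _ => (hπ.integrable_comp_of_integrable integrable_condExp).integrableOn) ?_
    (stronglyMeasurable_condExp.comp_measurable (comap_measurable π)).aestronglyMeasurable
  rintro _ ⟨s, hs, rfl⟩ -
  have key : ∀ {g : Ω → ℝ}, Integrable g P →
      ∫ ω in π ⁻¹' s, (g ∘ π) ω ∂P' = ∫ ω in s, g ω ∂P := by
    intro g hg
    have h1 := (hπ.restrict_preimage (hm _ hs)).map_eq
    rw [← h1, integral_map hπ.measurable.aemeasurable]
    · rfl
    · rw [h1]; exact hg.integrableOn.aestronglyMeasurable
  rw [key integrable_condExp, key hf, setIntegral_condExp hm hf hs]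

theorem comap_completion_le (hπ : MeasurePreserving π P' P) :
    (completion P m).comap π ≤ completion P' (m.comap π) := by
  rintro _ ⟨s, ⟨t, ht, hst⟩, rfl⟩
  exact ⟨π ⁻¹' t, ⟨t, ht, rfl⟩, hπ.quasiMeasurePreserving.preimage_ae_eq hst⟩

theorem completion_comap_completion (hπ : MeasurePreserving π P' P) :
    completion P' ((completion P m).comap π) = completion P' (m.comap π) :=
  le_antisymm (completion_le_completion (comap_completion_le hπ))
    (completion_mono (MeasurableSpace.comap_mono le_completion))

end Pullback

/-! ### Immersion -/

section Immersion

variable {Ω : Type*} [mΩ : MeasurableSpace Ω] {P : Measure Ω}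

theorem pred_le (n : NonposInt) : pred n ≤ n := by
  rw [← Subtype.coe_le_coe]; simp only [pred]; omega

theorem isImmersed_iff_pred [IsProbabilityMeasure P] {F H : NegFiltration P} :
    IsImmersed F H ↔ ∀ n, F n ≤ H n ∧
      ∀ B, MeasurableSet[H (pred n)] B → P⟦B | F n⟧ =ᵐ[P] P⟦B | F (pred n)⟧ :=
  forall_congr' fun n => and_congr_right fun _ =>
    condIndepFields_iff (F.mono' (pred_le n)) (F.le' n) (H.le' _)

theorem NonposInt.induction_pred {p : NonposInt → Prop} (h0 : p 0) (h : ∀ n, p n → p (pred n))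
    (n : NonposInt) : p n := by
  obtain ⟨k, hk⟩ := n
  obtain ⟨j, rfl⟩ : ∃ j : ℕ, k = -(j : ℤ) := ⟨k.natAbs, by omega⟩
  induction j with
  | zero => exact h0
  | succ j ih =>
    have := h _ (ih (by omega))
    convert this using 2
    simp only [pred]
    push_cast
    ring

/-- The one-step equalities telescope, since an event of `H (pred n)` also belongs to `H n`. Unlike
the one-step form, this one passes at once to any monotone time change. -/
theorem isImmersed_iff [IsProbabilityMeasure P] {F H : NegFiltration P} :
    IsImmersed F H ↔ ∀ n, F n ≤ H n ∧
      ∀ B, MeasurableSet[H n] B → P⟦B | F 0⟧ =ᵐ[P] P⟦B | F n⟧ := by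
  rw [isImmersed_iff_pred]
  constructor
  · intro h n
    refine ⟨(h n).1, ?_⟩
    induction n using NonposInt.induction_pred with
    | h0 => exact fun _ _ => ae_eq_refl _
    | h n ih =>
      exact fun B hB => (ih B (H.mono' (pred_le n) B hB)).trans ((h n).2 B hB)
  · intro h n
    refine ⟨(h n).1, fun B hB => ?_⟩
    exact condExp_eq_of_le_of_le (F.mono' (pred_le n)) (F.mono' (NonposInt.le_zero n)) (F.le' 0)
      ((h _).2 B hB)

end Immersion

/-! ### Coding a set of coordinates by one real variable -/

section Block

variable {Ω : Type u}

open Classical in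
/-- A real random variable which encodes the restriction to `I` of a real process. -/
noncomputable def block (V : NonposInt → Ω → ℝ) (I : Set NonposInt) (ω : Ω) : ℝ :=
  embeddingReal (NonposInt → ℝ) fun k => if k ∈ I then V k ω else 0

theorem comap_block (V : NonposInt → Ω → ℝ) (I : Set NonposInt) :
    MeasurableSpace.comap (block V I) Real.measurableSpace =
      ⨆ k ∈ I, MeasurableSpace.comap (V k) Real.measurableSpace := by
  classical
  have hE := measurableEmbedding_embeddingReal (NonposInt → ℝ)
  have e : block V I =
      embeddingReal (NonposInt → ℝ) ∘ fun ω k => if k ∈ I then V k ω else 0 := by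
    ext ω
    unfold block
    rw [Function.comp_apply]
  rw [e, ← MeasurableSpace.comap_comp, hE.comap_eq]
  apply le_antisymm
  · refine Measurable.comap_le ?_
    refine @measurable_pi_lambda _ _ _ (_) _ _ fun k => ?_
    by_cases hk : k ∈ I
    · simp only [hk, if_true]
      exact (comap_measurable (V k)).mono
        (le_iSup₂_of_le (f := fun k (_ : k ∈ I) => MeasurableSpace.comap (V k) Real.measurableSpace)
          k hk le_rfl) le_rfl
    · simp only [hk, if_false]
      exact measurable_const
  · refine iSup₂_le fun k hk => ?_
    have e1 : V k = (fun x : NonposInt → ℝ => x k) ∘ fun ω k => if k ∈ I then V k ω else 0 := by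
      ext ω; simp [hk]
    conv_lhs => rw [e1, ← MeasurableSpace.comap_comp]
    exact MeasurableSpace.comap_mono (measurable_pi_apply k).comap_le

theorem comap_block_Iic (V : NonposInt → Ω → ℝ) (n : NonposInt) :
    MeasurableSpace.comap (block V (Set.Iic n)) Real.measurableSpace =
      ⨆ k : Set.Iic n, MeasurableSpace.comap (V k) Real.measurableSpace := by
  rw [comap_block, iSup_subtype']

end Block

/-! ### Stability of standardness under time changes -/

section Constructions

variable {Ω : Type u} [mΩ : MeasurableSpace Ω] {P : Measure Ω}

theorem iIndep_biSup_of_pairwise_disjoint {ι κ : Type*} [IsProbabilityMeasure P]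
    {m : ι → MeasurableSpace Ω} (hm : ∀ i, m i ≤ mΩ) (h : iIndep m P) {I : κ → Set ι}
    (hI : Pairwise (Function.onFun Disjoint I)) : iIndep (fun j => ⨆ i ∈ I j, m i) P := by
  classical
  rw [iIndep_iff]
  intro s
  induction s using Finset.induction_on with
  | empty => simp
  | insert a s ha ih =>
    intro f hf
    have hind := indep_iSup_of_disjoint hm h (S := I a) (T := ⋃ j ∈ s, I j)
      (Set.disjoint_iUnion₂_right.2 fun j hj => hI (by rintro rfl; exact ha hj))
    rw [Finset.set_biInter_insert, Finset.prod_insert ha,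
      ← ih fun i hi => hf i (Finset.mem_insert_of_mem hi)]
    refine (Indep_iff _ _ _).1 hind _ _ (hf a (Finset.mem_insert_self a s)) ?_
    refine Finset.measurableSet_biInter s fun j hj => ?_
    refine (?_ : (⨆ i ∈ I j, m i) ≤ _) _ (hf j (Finset.mem_insert_of_mem hj))
    exact biSup_mono fun i hi => Set.mem_biUnion hj hi

theorem measurable_block {V : NonposInt → Ω → ℝ} (hV : ∀ n, Measurable (V n))
    (I : Set NonposInt) : Measurable (block V I) := by
  rw [measurable_iff_comap_le, comap_block]
  exact iSup₂_le fun k _ => (hV k).comap_le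

theorem coe_iterate_pred (n : NonposInt) (i : ℕ) : ((pred^[i] n : NonposInt) : ℤ) = n - i := by
  induction i with
  | zero => simp
  | succ i ih =>
    rw [Function.iterate_succ_apply']
    simp only [pred] at ih ⊢
    rw [ih]; push_cast; ring

theorem le_iff_eq_iterate_pred {m n : NonposInt} : m ≤ n ↔ ∃ i : ℕ, m = pred^[i] n := by
  constructor
  · intro h
    rw [← Subtype.coe_le_coe] at h
    exact ⟨((n : ℤ) - m).toNat, Subtype.ext (by rw [coe_iterate_pred]; omega)⟩
  · rintro ⟨i, rfl⟩
    rw [← Subtype.coe_le_coe, coe_iterate_pred]; omega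

theorem monotone_of_pred_le {α : Type*} [Preorder α] {f : NonposInt → α}
    (h : ∀ n, f (pred n) ≤ f n) : Monotone f := by
  intro m n hmn
  obtain ⟨i, rfl⟩ := le_iff_eq_iterate_pred.1 hmn
  clear hmn
  induction i with
  | zero => exact le_rfl
  | succ i ih => rw [Function.iterate_succ_apply']; exact (h _).trans ih

/-- The filtration `(F_{s(n)})_{n ≤ 0}`, with `s` non-decreasing. -/
def NegFiltration.comp (F : NegFiltration P) (s : NonposInt → NonposInt) (hs : Monotone s) :
    NegFiltration P where
  seq n := F (s n)
  mono' _ _ h := F.mono' (hs h)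
  le' n := F.le' (s n)
  complete n := F.complete (s n)
  separable n := F.separable (s n)

/-- The filtration of the complete σ-fields generated by real random variables. -/
def NegFiltration.ofGenerators (hc : ∀ s : Set Ω, P s = 0 → MeasurableSet s)
    (Z : NonposInt → Ω → ℝ) (hZ : ∀ n, Measurable (Z n))
    (hmono : ∀ n, MeasurableSpace.comap (Z (pred n)) Real.measurableSpace ≤
      completion P (MeasurableSpace.comap (Z n) Real.measurableSpace)) : NegFiltration P where
  seq n := completion P (MeasurableSpace.comap (Z n) Real.measurableSpace)
  mono' := monotone_of_pred_le fun n => completion_le_completion (hmono n)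
  le' n := completion_le_of_complete hc (hZ n).comap_le
  complete _ _ hs := measurableSet_completion_of_null hs
  separable n := by
    obtain ⟨b, hb, hgen⟩ := MeasurableSpace.CountablyGenerated.isCountablyGenerated (α := ℝ)
    obtain ⟨e, he⟩ := (hb.insert ∅).exists_eq_range ⟨∅, Set.mem_insert _ _⟩
    refine ⟨fun i => Z n ⁻¹' e i, ?_⟩
    congr 1
    have h1 : Real.measurableSpace = MeasurableSpace.generateFrom (Set.range e) := by
      rw [← he, MeasurableSpace.generateFrom_insert_empty]; exact hgen
    rw [h1, MeasurableSpace.comap_generateFrom, ← Set.range_comp]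
    rfl

/-- The new independent variables are the blocks of old ones. Unboundedness of `s` is what makes the
blocks up to `n` exhaust all indices `k ≤ s n`. -/
theorem IsProductType.comp [IsProbabilityMeasure P] {H : NegFiltration P} (hH : IsProductType H)
    {s : NonposInt → NonposInt} (hs : Monotone s) (hs' : ∀ m, ∃ n, s n ≤ m) :
    IsProductType (H.comp s hs) := by
  obtain ⟨V, hV, hind, hgen⟩ := hH
  let I : NonposInt → Set NonposInt := fun n => {k | k ≤ s n ∧ ¬ k ≤ s (pred n)}
  refine ⟨fun n => block V (I n), fun n => measurable_block hV _, ?_, fun n => ?_⟩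
  · have h1 : Pairwise (Function.onFun Disjoint I) := by
      rw [pairwise_disjoint_on]
      intro i j hij
      rw [Set.disjoint_left]
      rintro k ⟨hk, -⟩ ⟨-, hk'⟩
      refine hk' (hk.trans (hs ?_))
      rw [← Subtype.coe_lt_coe] at hij
      rw [← Subtype.coe_le_coe]; simp only [pred]; omega
    have h2 := iIndep_biSup_of_pairwise_disjoint (fun n => (hV n).comap_le) hind.iIndep h1
    rw [iIndepFun_iff_iIndep]
    simp only [comap_block]
    exact h2
  · change H (s n) = _
    rw [hgen (s n)]
    congr 1
    simp only [comap_block]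
    apply le_antisymm
    · refine iSup_le fun ⟨k, hk⟩ => ?_
      obtain ⟨j, hj, hkj⟩ : ∃ j ≤ n, k ∈ I j := by
        -- An index lying in no block would stay below `s` at every earlier time, although `s`
        -- eventually drops below `pred k`.
        by_contra! hcon
        have h1 : ∀ i : ℕ, k ≤ s (pred^[i] n) := by
          intro i
          induction i with
          | zero => exact hk
          | succ i ih =>
            by_contra h2
            rw [Function.iterate_succ_apply'] at h2
            exact hcon _ (le_iff_eq_iterate_pred.2 ⟨i, rfl⟩) ⟨ih, h2⟩
        obtain ⟨j, hj⟩ := hs' (pred k)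
        obtain ⟨i, hi⟩ := le_iff_eq_iterate_pred.1 (min_le_right j n)
        have h2 := ((h1 i).trans (hs (hi ▸ min_le_left j n))).trans hj
        rw [← Subtype.coe_le_coe] at h2
        simp only [pred] at h2
        omega
      exact le_iSup_of_le ⟨j, hj⟩ (le_iSup₂_of_le (f := fun k (_ : k ∈ I j) =>
        MeasurableSpace.comap (V k) Real.measurableSpace) k hkj le_rfl)
    · refine iSup_le fun ⟨j, hj⟩ => iSup₂_le fun k hk => ?_
      exact le_iSup (fun k : Set.Iic (s n) => MeasurableSpace.comap (V k) Real.measurableSpace)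
        ⟨k, hk.1.trans (hs hj)⟩

theorem IsImmersed.comp [IsProbabilityMeasure P] {F H : NegFiltration P} (h : IsImmersed F H)
    {s : NonposInt → NonposInt} (hs : Monotone s) : IsImmersed (F.comp s hs) (H.comp s hs) := by
  rw [isImmersed_iff] at h ⊢
  intro n
  refine ⟨(h (s n)).1, fun B hB => ?_⟩
  exact condExp_eq_of_le_of_le (F.mono' (hs (NonposInt.le_zero n)))
    (F.mono' (NonposInt.le_zero _)) (F.le' 0) ((h (s n)).2 B hB)

theorem IsIsomorphic.comp {Ω' : Type v} [MeasurableSpace Ω'] {P' : Measure Ω'}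
    [IsProbabilityMeasure P] [IsProbabilityMeasure P'] {F : NegFiltration P}
    {F' : NegFiltration P'} (h : IsIsomorphic F F') {s : NonposInt → NonposInt} (hs : Monotone s) :
    IsIsomorphic (F.comp s hs) (F'.comp s hs) := by
  obtain ⟨Z, Z', hZ, hZ', hlaw⟩ := h.exists_generators
  refine isIsomorphic_of_generators (Z := fun n => Z (s n)) (Z' := fun n => Z' (s n))
    (fun n => hZ (s n)) (fun n => hZ' (s n)) ?_
  have hm : Measurable fun (z : NonposInt → ℝ) n => z (s n) :=
    measurable_pi_lambda _ fun n => measurable_pi_apply _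
  have := congrArg (Measure.map fun z n => z (s n)) hlaw
  rwa [Measure.map_map hm (measurable_pi_lambda _ fun n => F.measurable_of_generates (hZ n)),
    Measure.map_map hm (measurable_pi_lambda _ fun n => F'.measurable_of_generates (hZ' n))] at this

theorem IsStandard.comp [IsProbabilityMeasure P] {F : NegFiltration P} (h : IsStandard F)
    {s : NonposInt → NonposInt} (hs : Monotone s) (hs' : ∀ m, ∃ n, s n ≤ m) :
    IsStandard (F.comp s hs) := by
  obtain ⟨Ω', _, P', _, H, hH, F', hiso, himm⟩ := h
  exact ⟨Ω', _, P', ‹_›, H.comp s hs, hH.comp hs hs', F'.comp s hs, hiso.comp hs, himm.comp hs⟩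

end Constructions

/-! ### Appending a last term to a sequence -/

section Cons

/-- The sequence `x`, shifted one step to the past, followed by `a`. -/
def cons {α : Type*} (a : α) (x : NonposInt → α) (n : NonposInt) : α :=
  if h : (n : ℤ) = 0 then a else x ⟨n + 1, by have := n.2; omega⟩

@[simp] theorem cons_zero {α : Type*} (a : α) (x : NonposInt → α) : cons a x 0 = a :=
  dif_pos rfl

@[simp] theorem cons_pred {α : Type*} (a : α) (x : NonposInt → α) (n : NonposInt) :
    cons a x (pred n) = x n := by
  have h : ((pred n : NonposInt) : ℤ) ≠ 0 := by have := n.2; simp only [pred]; omega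
  rw [cons, dif_neg h]
  congr 1
  exact Subtype.ext (by simp [pred])

theorem NonposInt.cases_pred {p : NonposInt → Prop} (h0 : p 0) (h : ∀ n, p (pred n))
    (n : NonposInt) : p n :=
  NonposInt.induction_pred h0 (fun n _ => h n) n

theorem pred_injective : Function.Injective pred := fun m n h => by
  have := congrArg Subtype.val h
  simp only [pred] at this
  exact Subtype.ext (by omega)

theorem pred_ne_zero (n : NonposInt) : pred n ≠ 0 := fun h => by
  have h1 := congrArg Subtype.val h
  have h2 := n.2
  change (n : ℤ) - 1 = 0 at h1
  omega

theorem pred_monotone : Monotone pred := fun m n h => by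
  rw [← Subtype.coe_le_coe] at h ⊢; simp only [pred]; omega

theorem pred_le_pred_iff {m n : NonposInt} : pred m ≤ pred n ↔ m ≤ n := by
  rw [← Subtype.coe_le_coe, ← Subtype.coe_le_coe]; simp only [pred]; omega

theorem measurable_cons {α β : Type*} [MeasurableSpace α] [MeasurableSpace β] {f : α → β}
    {g : NonposInt → α → β} (hf : Measurable f) (hg : ∀ n, Measurable (g n)) (n : NonposInt) :
    Measurable (cons f g n) := by
  induction n using NonposInt.cases_pred with
  | h0 => simpa using hf
  | h n => simpa using hg n

end Cons

/-! ### Extension by an independent uniform variable -/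

section Extension

variable {Ω : Type u} {Ω' : Type v} {m : MeasurableSpace Ω} [mΩ : MeasurableSpace Ω] [mΩ' : MeasurableSpace Ω']
  {P : Measure Ω} {P' : Measure Ω'} {π : Ω' → Ω} {U : Ω' → unitInterval}

theorem measurePreserving_completion (P : Measure Ω) :
    @MeasurePreserving (NullMeasurableSpace Ω P) Ω _ _ id P.completion P := by
  have h : @Measurable (NullMeasurableSpace Ω P) Ω _ _ id :=
    fun s hs => MeasurableSet.nullMeasurableSet (μ := P) hs
  refine ⟨h, ?_⟩
  refine Measure.ext fun s hs => ?_
  exact (Measure.map_apply h hs).trans (Measure.completion_apply P s)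

/-- The product measure is completed because the σ-fields of a `NegFiltration` contain all null
sets. -/
theorem exists_uniform_extension (P : Measure Ω) [IsProbabilityMeasure P] :
    ∃ (Ω₁ : Type u) (_ : MeasurableSpace Ω₁) (P₁ : Measure Ω₁) (π : Ω₁ → Ω)
      (U : Ω₁ → unitInterval), (∀ s, P₁ s = 0 → MeasurableSet s) ∧
      MeasurePreserving (fun ω => (π ω, U ω)) P₁ (P.prod volume) :=
  ⟨NullMeasurableSpace (Ω × unitInterval) (P.prod volume), inferInstance,
    (P.prod volume).completion, fun ω => Prod.fst ω, fun ω => Prod.snd ω,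
    fun s hs => (Measure.completion.isComplete (P.prod volume)).out' s hs,
    measurePreserving_completion (P.prod volume)⟩

theorem indepFun_of_measurePreserving_prod [IsProbabilityMeasure P] [IsProbabilityMeasure P']
    (h : MeasurePreserving (fun ω => (π ω, U ω)) P' (P.prod volume)) :
    Measurable π ∧ Measurable U ∧ MeasurePreserving π P' P ∧ IndepFun π U P' := by
  have h1 : MeasurePreserving π P' P := measurePreserving_fst.comp h
  have h2 : MeasurePreserving U P' volume := measurePreserving_snd.comp h
  refine ⟨h1.measurable, h2.measurable, h1, ?_⟩
  rw [indepFun_iff_map_prod_eq_prod_map_map h1.measurable.aemeasurable h2.measurable.aemeasurable,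
    h.map_eq, h1.map_eq, h2.map_eq]

/-- Since `U` is uniform and independent of `π`, feeding it to `g x` samples from `κ x`
conditionally on `X = x`. -/
theorem map_eq_compProd [IsProbabilityMeasure P] [IsProbabilityMeasure P']
    (h : MeasurePreserving (fun ω => (π ω, U ω)) P' (P.prod volume))
    {E : Type*} [MeasurableSpace E] {X : Ω → E} (hX : Measurable X) (κ : Kernel E ℝ)
    [IsMarkovKernel κ] {g : E → unitInterval → ℝ} (hg : Measurable (Function.uncurry g))
    (hgκ : ∀ x, volume.map (g x) = κ x) :
    P'.map (fun ω => (X (π ω), g (X (π ω)) (U ω))) = P.map X ⊗ₘ κ := by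
  have hm : Measurable fun p : Ω × unitInterval => (X p.1, g (X p.1) p.2) :=
    (hX.comp measurable_fst).prodMk (hg.comp ((hX.comp measurable_fst).prodMk measurable_snd))
  have e : (fun ω => (X (π ω), g (X (π ω)) (U ω))) =
      (fun p : Ω × unitInterval => (X p.1, g (X p.1) p.2)) ∘ fun ω => (π ω, U ω) := rfl
  have := Measure.isProbabilityMeasure_map (μ := P) hX.aemeasurable
  rw [e, ← Measure.map_map hm h.measurable, h.map_eq]
  ext s hs
  rw [Measure.map_apply hm hs, Measure.prod_apply (hm hs), Measure.compProd_apply hs,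
    lintegral_map (Kernel.measurable_kernel_prodMk_left hs) hX]
  refine lintegral_congr fun ω => ?_
  rw [← hgκ, Measure.map_apply (hg.of_uncurry_left) (measurable_prodMk_left hs)]
  rfl

theorem iIndepFun_cons [IsProbabilityMeasure P] [IsProbabilityMeasure P']
    (hπ : MeasurePreserving π P' P) {W : Ω' → ℝ} (hW : IndepFun π W P')
    {V : NonposInt → Ω → ℝ} (hV : ∀ n, Measurable (V n)) (h : iIndepFun V P) :
    iIndepFun (cons W fun n => V n ∘ π) P' := by
  classical
  rw [iIndepFun_iff_measure_inter_preimage_eq_mul] at h ⊢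
  have key : ∀ (T : Finset NonposInt) {s : NonposInt → Set ℝ},
      (∀ i ∈ T.image pred, MeasurableSet (s i)) →
      (⋂ i ∈ T.image pred, cons W (fun n => V n ∘ π) i ⁻¹' s i) =
        π ⁻¹' (⋂ j ∈ T, V j ⁻¹' s (pred j)) ∧
      MeasurableSet (⋂ j ∈ T, V j ⁻¹' s (pred j)) ∧
      P (⋂ j ∈ T, V j ⁻¹' s (pred j)) =
        ∏ i ∈ T.image pred, P' (cons W (fun n => V n ∘ π) i ⁻¹' s i) := by
    intro T s hs
    have hs' : ∀ j ∈ T, MeasurableSet (s (pred j)) := fun j hj =>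
      hs _ (Finset.mem_image_of_mem _ hj)
    refine ⟨?_, Finset.measurableSet_biInter _ fun j hj => hV j (hs' j hj), ?_⟩
    · ext ω
      simp only [Set.mem_iInter, Set.mem_preimage, Finset.mem_image, forall_exists_index, and_imp,
        forall_apply_eq_imp_iff₂, cons_pred, Function.comp_apply]
    · rw [Finset.prod_image pred_injective.injOn, h T hs']
      refine Finset.prod_congr rfl fun j hj => ?_
      rw [cons_pred, Set.preimage_comp,
        hπ.measure_preimage (hV j (hs' j hj)).nullMeasurableSet]
  intro S s hs
  -- All indices other than `0` are predecessors: they involve only the old variables, and `W` is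
  -- split off when `0 ∈ S`.
  obtain ⟨T, hT⟩ : ∃ T : Finset NonposInt, S.erase 0 = T.image pred := by
    refine ⟨(S.erase 0).preimage pred pred_injective.injOn, ?_⟩
    rw [Finset.image_preimage, Finset.filter_true_of_mem]
    intro n hn
    induction n using NonposInt.cases_pred with
    | h0 => simp at hn
    | h n => exact ⟨n, rfl⟩
  obtain ⟨k1, k2, k3⟩ := key T (s := s)
    (fun i hi => hs i (Finset.mem_of_mem_erase (hT.symm ▸ hi)))
  rw [← hT] at k1 k3
  by_cases h0 : (0 : NonposInt) ∈ S
  · rw [← Finset.insert_erase h0, Finset.set_biInter_insert,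
      Finset.prod_insert (Finset.notMem_erase _ _), k1, ← k3, cons_zero, Set.inter_comm,
      hW.measure_inter_preimage_eq_mul _ _ k2 (hs 0 h0), hπ.measure_preimage k2.nullMeasurableSet,
      mul_comm]
  · rw [Finset.erase_eq_of_notMem h0] at k1 k3
    rw [k1, hπ.measure_preimage k2.nullMeasurableSet, k3]

theorem condExp_completion_comap [IsProbabilityMeasure P] [IsProbabilityMeasure P']
    (hπ : MeasurePreserving π P' P) (hm : m ≤ mΩ)
    (hm' : completion P' (m.comap π) ≤ mΩ') {B : Set Ω} (hB : MeasurableSet B) :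
    P'⟦π ⁻¹' B | completion P' (m.comap π)⟧ =ᵐ[P'] P⟦B | m⟧ ∘ π :=
  (condExp_completion hm' (integrable_indicator_one (hπ.measurable hB))).trans
    (condExp_comap hπ hm (integrable_indicator_one hB))

end Extension

/-! ### Standardness does not depend on finitely many last steps -/

section Tail

variable {Ω : Type u} [mΩ : MeasurableSpace Ω] {P : Measure Ω}

/-- Only the last step is new. There `F₁ 0` lies between the completed pullback of `F 0` and its
join with `σ(U)`; as `U` is independent of the pullback of `H 0`, both ends predict the past of `H₁`
equally well, hence so does `F₁ 0`. -/
theorem isImmersed_extension {Ω₁ : Type v} [mΩ₁ : MeasurableSpace Ω₁] {P₁ : Measure Ω₁}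
    [IsProbabilityMeasure P] [IsProbabilityMeasure P₁] {π : Ω₁ → Ω} {U : Ω₁ → unitInterval}
    (hπ : MeasurePreserving π P₁ P) (hU : Measurable U) (hind : IndepFun π U P₁)
    {F H : NegFiltration P} (himm : IsImmersed F H) {F₁ H₁ : NegFiltration P₁}
    (hF : ∀ n, F₁ (pred n) = completion P₁ ((F n).comap π))
    (hF0 : F₁ 0 ≤ completion P₁ ((F 0).comap π ⊔ MeasurableSpace.comap U inferInstance))
    (hH : ∀ n, H₁ (pred n) = completion P₁ ((H n).comap π))
    (hH0 : MeasurableSpace.comap U inferInstance ≤ H₁ 0) : IsImmersed F₁ H₁ := by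
  rw [isImmersed_iff_pred] at himm ⊢
  have hFle : ∀ n, (F n).comap π ≤ mΩ₁ := fun n =>
    (MeasurableSpace.comap_mono (F.le' n)).trans hπ.measurable.comap_le
  have hHle : ∀ n, (H n).comap π ≤ mΩ₁ := fun n =>
    (MeasurableSpace.comap_mono (H.le' n)).trans hπ.measurable.comap_le
  have hHpred : (H 0).comap π ≤ H₁ (pred 0) := by rw [hH]; exact le_completion
  have hH0' := hHpred.trans (H₁.mono' (pred_le 0))
  intro n
  induction n using NonposInt.cases_pred with
  | h0 =>
    refine ⟨hF0.trans (completion_le_of_complete (H₁.complete 0) (sup_le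
      ((MeasurableSpace.comap_mono (himm 0).1).trans hH0') hH0)), fun B hB => ?_⟩
    rw [hH] at hB
    obtain ⟨B₀, hB₀, hBB₀⟩ := hB
    have hB₀m : MeasurableSet B₀ := hHle 0 _ hB₀
    have hsup : completion P₁ ((F 0).comap π ⊔ MeasurableSpace.comap U inferInstance) ≤ mΩ₁ :=
      completion_le_of_complete H₁.complete_space (sup_le (hFle 0) hU.comap_le)
    have hindep : Indep ((H 0).comap π) (MeasurableSpace.comap U inferInstance) P₁ :=
      indep_of_indep_of_le_left hind (MeasurableSpace.comap_mono (H.le' 0))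
    have e := condExp_sup_of_indep (MeasurableSpace.comap_mono (himm 0).1) (hHle 0) hU.comap_le
      hindep hB₀
    have hpred : completion P₁ ((F 0).comap π) ≤ mΩ₁ := hF 0 ▸ F₁.le' _
    have e1 : P₁⟦B₀ | completion P₁ ((F 0).comap π ⊔ MeasurableSpace.comap U inferInstance)⟧
        =ᵐ[P₁] P₁⟦B₀ | F₁ (pred 0)⟧ := by
      rw [hF]
      exact (condExp_completion hsup (integrable_indicator_one hB₀m)).trans
        (e.trans (condExp_completion hpred (integrable_indicator_one hB₀m)).symm)
    exact (condExp_indicator_congr hBB₀).trans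
      ((condExp_eq_of_le_of_le (F₁.mono' (pred_le 0)) hF0 hsup e1).trans
        (condExp_indicator_congr hBB₀).symm)
  | h n =>
    refine ⟨by rw [hF, hH]; exact completion_mono (MeasurableSpace.comap_mono (himm n).1),
      fun B hB => ?_⟩
    rw [hH] at hB
    obtain ⟨_, ⟨B₀, hB₀, rfl⟩, hBB₀⟩ := hB
    have hB₀m : MeasurableSet B₀ := H.le' _ _ hB₀
    have key : ∀ k, P₁⟦B | F₁ (pred k)⟧ =ᵐ[P₁] P⟦B₀ | F k⟧ ∘ π := by
      intro k
      refine (condExp_indicator_congr hBB₀).trans ?_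
      rw [hF]
      exact condExp_completion_comap hπ (F.le' k) (hF k ▸ F₁.le' _) hB₀m
    exact (key n).trans (Filter.EventuallyEq.trans
      (hπ.quasiMeasurePreserving.ae_eq_comp ((himm n).2 B₀ hB₀)) (key (pred n)).symm)

theorem exists_isProductType_extension {Ω₁ : Type v} [mΩ₁ : MeasurableSpace Ω₁] {P₁ : Measure Ω₁}
    [IsProbabilityMeasure P] [IsProbabilityMeasure P₁] {π : Ω₁ → Ω} {U : Ω₁ → unitInterval}
    (hc : ∀ s, P₁ s = 0 → MeasurableSet s)
    (hπ : MeasurePreserving π P₁ P) (hU : Measurable U) (hind : IndepFun π U P₁)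
    {H : NegFiltration P} (hprod : IsProductType H) :
    ∃ H₁ : NegFiltration P₁, IsProductType H₁ ∧
      (∀ n, H₁ (pred n) = completion P₁ ((H n).comap π)) ∧
      MeasurableSpace.comap U inferInstance ≤ H₁ 0 := by
  obtain ⟨V, hV, hVi, hgen⟩ := hprod
  let W : NonposInt → Ω₁ → ℝ := cons (fun ω => (U ω : ℝ)) fun n => V n ∘ π
  have hW : ∀ n, Measurable (W n) :=
    measurable_cons (measurable_subtype_coe.comp hU) fun n => (hV n).comp hπ.measurable
  refine ⟨NegFiltration.ofGenerators hc (fun n => block W (Set.Iic n))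
    (fun n => measurable_block hW _) (fun n => ?_), ⟨W, hW, ?_, fun n => ?_⟩, fun n => ?_, ?_⟩
  · rw [comap_block, comap_block]
    exact (biSup_mono fun k hk => le_trans hk (pred_le n)).trans le_completion
  · exact iIndepFun_cons hπ (hind.comp measurable_id measurable_subtype_coe) hV hVi
  · change completion P₁ (MeasurableSpace.comap (block W (Set.Iic n)) _) = _
    rw [comap_block_Iic]
  · change completion P₁ (MeasurableSpace.comap (block W (Set.Iic (pred n))) _) = _
    rw [hgen n, completion_comap_completion hπ, comap_block, MeasurableSpace.comap_iSup]
    congr 1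
    apply le_antisymm
    · refine iSup₂_le fun k hk => ?_
      induction k using NonposInt.cases_pred with
      | h0 =>
        exact absurd (le_antisymm (NonposInt.le_zero _) hk) (pred_ne_zero n)
      | h k =>
        refine le_iSup_of_le ⟨k, pred_le_pred_iff.1 hk⟩ ?_
        rw [MeasurableSpace.comap_comp]
        simp only [W, cons_pred]
        exact le_rfl
    · refine iSup_le fun ⟨k, hk⟩ => ?_
      refine le_trans ?_ (le_iSup₂_of_le
        (f := fun k (_ : k ∈ Set.Iic (pred n)) => MeasurableSpace.comap (W k) Real.measurableSpace)
        (pred k) (pred_le_pred_iff.2 hk) le_rfl)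
      rw [MeasurableSpace.comap_comp]
      simp only [W, cons_pred]
      exact le_rfl
  · change _ ≤ completion P₁ (MeasurableSpace.comap (block W (Set.Iic 0)) _)
    rw [comap_block]
    refine le_trans ?_ ((le_iSup₂_of_le
      (f := fun k (_ : k ∈ Set.Iic (0 : NonposInt)) =>
        MeasurableSpace.comap (W k) Real.measurableSpace)
      0 (Set.mem_Iic.2 le_rfl) le_rfl).trans le_completion)
    simp only [W, cons_zero]
    rw [show (fun ω => (U ω : ℝ)) = Subtype.val ∘ U from rfl, ← MeasurableSpace.comap_comp]
    exact le_rfl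

/-- The shifted filtration is already copied on `Ω'`; what remains is to copy a generator `Z` of `F
0` jointly with the past. -/
theorem IsStandard.of_comp_pred [IsProbabilityMeasure P] {F : NegFiltration P}
    (h : IsStandard (F.comp pred pred_monotone)) : IsStandard F := by
  obtain ⟨Ω', _, P', _, H, hH, F', hiso, himm⟩ := h
  obtain ⟨Y, Y', hY, hY', hlaw⟩ := hiso.exists_generators
  obtain ⟨Z, hZ⟩ : ∃ Z : Ω → ℝ, Generates P Z (F 0) := by
    obtain ⟨Z, hZ⟩ := F.exists_generators
    exact ⟨Z 0, hZ 0⟩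
  have hZm := F.measurable_of_generates hZ
  have hYm := fun n => F.measurable_of_generates (hY n)
  have hYm' := fun n => F'.measurable_of_generates (hY' n)
  let X : Ω → NonposInt → ℝ := fun ω n => Y n ω
  let X' : Ω' → NonposInt → ℝ := fun ω n => Y' n ω
  have hX : Measurable X := measurable_pi_lambda _ hYm
  have hX' : Measurable X' := measurable_pi_lambda _ hYm'
  obtain ⟨g, hg, hgκ⟩ := (condDistrib Z X P).exists_measurable_map_eq_unitInterval
  obtain ⟨Ω₁, _, P₁, π, U, hc, hπU⟩ := exists_uniform_extension P'
  have hP₁ : IsProbabilityMeasure P₁ := by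
    refine ⟨?_⟩
    rw [← Set.preimage_univ (f := fun ω => (π ω, U ω)),
      hπU.measure_preimage MeasurableSet.univ.nullMeasurableSet]
    exact measure_univ
  obtain ⟨hπm, hUm, hπ, hind⟩ := indepFun_of_measurePreserving_prod hπU
  -- `Z₁` is drawn from the conditional law of `Z` given the sequence `X`, evaluated at its copy
  -- `X'`, so `(X', Z₁)` has the law of `(X, Z)`.
  let Z₁ : Ω₁ → ℝ := fun ω => g (X' (π ω)) (U ω)
  have hZ₁ : Measurable Z₁ := hg.comp ((hX'.comp hπm).prodMk hUm)
  have hjoint : P.map (fun ω => (X ω, Z ω)) = P₁.map (fun ω => (X' (π ω), Z₁ ω)) := by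
    rw [map_eq_compProd hπU hX' _ hg hgκ, show P'.map X' = P.map X from hlaw.symm,
      compProd_map_condDistrib hZm.aemeasurable]
  let T : NonposInt → Ω₁ → ℝ := cons Z₁ fun n => Y' n ∘ π
  have hT : ∀ n, Measurable (T n) := measurable_cons hZ₁ fun n => (hYm' n).comp hπm
  have hpred : ∀ n, completion P₁ (MeasurableSpace.comap (T (pred n)) Real.measurableSpace) =
      completion P₁ ((F' n).comap π) := by
    intro n
    rw [show F' n = _ from hY' n, completion_comap_completion hπ, MeasurableSpace.comap_comp]
    simp only [T, cons_pred]
  have hmono : ∀ n, MeasurableSpace.comap (T (pred n)) Real.measurableSpace ≤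
      completion P₁ (MeasurableSpace.comap (T n) Real.measurableSpace) := by
    intro n
    induction n using NonposInt.cases_pred with
    | h0 =>
      -- `Z₁` must determine the past by itself: `Y 0 = k (Z)` almost surely, and this passes to the
      -- copy through the joint law.
      have h1 := (hY 0).measurable.mono (F.mono' (pred_le 0)) le_rfl
      rw [show F.seq 0 = _ from hZ] at h1
      obtain ⟨k, hk, e⟩ := exists_measurable_comp_of_completion
        (by have := F.le' 0; rwa [show F.seq 0 = _ from hZ] at this) h1
      refine comap_le_completion_comap hk ?_
      simp only [T, cons_zero, cons_pred]
      exact ae_transfer (hX.prodMk hZm) ((hX'.comp hπm).prodMk hZ₁) hjoint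
        (s := {p | p.1 0 = k p.2})
        (measurableSet_eq_fun ((measurable_pi_apply _).comp measurable_fst)
          (hk.comp measurable_snd)) e
    | h n =>
      refine (le_completion (P := P₁)).trans ?_
      rw [hpred, hpred]
      exact completion_mono (MeasurableSpace.comap_mono (F'.mono' (pred_le n)))
  let F₁ : NegFiltration P₁ := NegFiltration.ofGenerators hc T hT hmono
  obtain ⟨H₁, hprod, hH₁, hH₁0⟩ := exists_isProductType_extension hc hπ hUm hind hH
  refine ⟨Ω₁, _, P₁, hP₁, H₁, hprod, F₁, ?_, ?_⟩
  · refine isIsomorphic_of_generators (Z := cons Z Y) (Z' := T) (fun n => ?_) (fun _ => rfl) ?_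
    · induction n using NonposInt.cases_pred with
      | h0 => simpa using hZ
      | h n => rw [cons_pred]; exact hY n
    · have hm : Measurable fun (p : (NonposInt → ℝ) × ℝ) n => cons p.2 p.1 n := by
        refine measurable_pi_lambda _ fun n => ?_
        induction n using NonposInt.cases_pred with
        | h0 => simpa using measurable_snd
        | h n => simp only [cons_pred]; exact (measurable_pi_apply n).comp measurable_fst
      have h1 := congrArg (Measure.map fun (p : (NonposInt → ℝ) × ℝ) n => cons p.2 p.1 n) hjoint
      rw [Measure.map_map hm (hX.prodMk hZm),
        Measure.map_map hm (show Measurable fun ω => (X' (π ω), Z₁ ω) from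
          (hX'.comp hπm).prodMk hZ₁)] at h1
      convert h1 using 2
      · ext ω n
        induction n using NonposInt.cases_pred <;> simp [X]
      · ext ω n
        induction n using NonposInt.cases_pred <;> simp [T, X']
  · refine isImmersed_extension hπ hUm hind himm hpred ?_ hH₁ hH₁0
    change completion P₁ (MeasurableSpace.comap (T 0) _) ≤ _
    refine completion_mono ?_
    simp only [T, cons_zero]
    refine Measurable.comap_le ?_
    have h1 : Measurable[F' 0] X' := @measurable_pi_lambda _ _ _ (F' 0) _ _ fun n =>
      (hY' n).measurable.mono (F'.mono' (NonposInt.le_zero n)) le_rfl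
    have h2 : Measurable[(F' 0).comap π ⊔ MeasurableSpace.comap U inferInstance]
        (fun ω => X' (π ω)) :=
      (h1.comp (comap_measurable π)).mono le_sup_left le_rfl
    have h3 : Measurable[(F' 0).comap π ⊔ MeasurableSpace.comap U inferInstance] U :=
      (comap_measurable U).mono le_sup_right le_rfl
    exact hg.comp (h2.prodMk h3)

theorem IsStandard.of_comp_iterate_pred [IsProbabilityMeasure P] (c : ℕ) {F : NegFiltration P}
    {s : NonposInt → NonposInt} (hs : Monotone s) (hsc : ∀ n, s n = pred^[c] n)
    (h : IsStandard (F.comp s hs)) : IsStandard F := by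
  obtain rfl : s = pred^[c] := funext hsc
  clear hsc
  induction c generalizing F with
  | zero => exact h
  | succ c ih =>
    refine IsStandard.of_comp_pred (ih (F := F.comp pred pred_monotone) ?_ ?_)
    · exact pred_monotone.iterate c
    · have e : (F.comp pred pred_monotone).comp pred^[c] (pred_monotone.iterate c) =
          F.comp pred^[c + 1] hs := by
        unfold NegFiltration.comp
        congr 2
        ext n
        rw [Function.iterate_succ_apply']
      rw [e]; exact h

end Tail

/-! ### Arithmetic of the blocks -/

section TimeChange

theorem slowIndex_le {φ : NonposInt → NonposInt} (hφ : StrictMono φ) (h0 : φ 0 = 0)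
    {n k : NonposInt} (h : n ≤ φ k) : slowIndex φ hφ h0 n ≤ k :=
  csInf_le (slowSet_bddBelow hφ n) ⟨k.2, h⟩

theorem le_apply_slowIndex {φ : NonposInt → NonposInt} (hφ : StrictMono φ) (h0 : φ 0 = 0)
    (n : NonposInt) : n ≤ φ (slowIndex φ hφ h0 n) := by
  obtain ⟨h, hn⟩ := Int.csInf_mem ⟨0, zero_mem_slowSet h0 n⟩ (slowSet_bddBelow hφ n)
  exact hn

theorem exists_slowIndex_dyadicTime (d : ℕ) {k : NonposInt} (hk : (k : ℤ) ≤ -2 * d - 2) :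
    ∃ t, slowIndex interlinkTime interlinkTime_strictMono interlinkTime_zero (dyadicTime d t)
      = k := by
  have key : ∀ (j : ℤ), j ≤ -(d + 1) → (2 : ℤ) ^ d * 2 ^ (j.natAbs - d) = 2 ^ j.natAbs := by
    intro j hj
    rw [← pow_add]; congr 1; omega
  have hd : (0 : ℤ) < 2 ^ d := by positivity
  obtain ⟨k, hk0⟩ := k
  simp only at hk
  rcases Int.even_or_odd' k with ⟨j, rfl | rfl⟩
  · have hj := key j (by omega)
    -- The block of `2j` is the single time `-2^|j|`, a multiple of `2^d`.
    refine ⟨⟨-2 ^ (j.natAbs - d), by simp⟩, slowIndex_eq _ _ _ _ ?_ ?_⟩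
    · change interlinkVal (2 * j - 1) + 1 ≤ 2 ^ d * -2 ^ (j.natAbs - d)
      rw [interlinkVal_odd j (by omega)]; linarith
    · change 2 ^ d * -2 ^ (j.natAbs - d) ≤ interlinkVal (2 * j)
      rw [interlinkVal_even j (by omega)]; linarith
  · have hj := key (j + 1) (by omega)
    have hlt : (2 : ℤ) ^ (d + 1) ≤ 2 ^ (j + 1).natAbs :=
      pow_le_pow_right₀ (by norm_num) (by omega)
    rw [pow_succ] at hlt
    -- The time chosen is `-2^|j+1| - 2^d`, the first multiple of `2^d` before `-2^|j+1|`. It comes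
    -- after `-2^|j|` because `2^d < 2^|j+1|`.
    refine ⟨⟨-(2 ^ ((j + 1).natAbs - d) + 1), by
      have : (0 : ℤ) < 2 ^ ((j + 1).natAbs - d) := by positivity
      omega⟩, slowIndex_eq _ _ _ _ ?_ ?_⟩
    · change interlinkVal (2 * j + 1 - 1) + 1 ≤ 2 ^ d * -(2 ^ ((j + 1).natAbs - d) + 1)
      rw [show 2 * j + 1 - 1 = 2 * j by ring, interlinkVal_even j (by omega),
        show j.natAbs = (j + 1).natAbs + 1 by omega, pow_succ]
      linarith
    · change 2 ^ d * -(2 ^ ((j + 1).natAbs - d) + 1) ≤ interlinkVal (2 * j + 1)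
      rw [show 2 * j + 1 = 2 * (j + 1) - 1 by ring, interlinkVal_odd (j + 1) (by omega)]
      linarith

theorem slowIndex_shiftedDyadicTime_zero {d : ℕ} (hd : 1 ≤ d) :
    -2 * (d : ℤ) - 1 < (slowIndex interlinkTime interlinkTime_strictMono interlinkTime_zero
      (shiftedDyadicTime d 0) : NonposInt) := by
  by_contra! h
  have h1 := le_apply_slowIndex interlinkTime_strictMono interlinkTime_zero (shiftedDyadicTime d 0)
  have h2 := interlinkTime_strictMono.monotone
    (show slowIndex interlinkTime interlinkTime_strictMono interlinkTime_zero
      (shiftedDyadicTime d 0) ≤ (⟨2 * -(d : ℤ) - 1, by omega⟩ : NonposInt) by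
      rw [← Subtype.coe_le_coe]; simp only; linarith)
  have h3 : (2 : ℤ) ^ d * 0 - 2 ^ (d - 1) ≤ interlinkVal (2 * -(d : ℤ) - 1) :=
    Subtype.coe_le_coe.2 (h1.trans h2)
  rw [interlinkVal_odd _ (by omega), show (-(d : ℤ)).natAbs = d by omega] at h3
  have h4 : (2 : ℤ) ^ (d - 1) ≤ 2 ^ d := pow_le_pow_right₀ (by norm_num) (by omega)
  linarith

theorem slowIndex_shiftedDyadicTime_of_neg {d : ℕ} (hd : 1 ≤ d) {n : NonposInt}
    (hn : (n : ℤ) < 0) : ∃ N : ℕ, d ≤ N ∧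
      ((slowIndex interlinkTime interlinkTime_strictMono interlinkTime_zero
        (shiftedDyadicTime d n) : NonposInt) : ℤ) = -2 * N - 1 := by
  obtain ⟨d, rfl⟩ : ∃ e, d = e + 1 := ⟨d - 1, by omega⟩
  obtain ⟨n, hn0⟩ := n
  obtain ⟨a, rfl⟩ : ∃ a : ℕ, n = -(a : ℤ) - 1 := ⟨(-n - 1).toNat, by simp only at hn; omega⟩
  -- With `d` lowered by one and `n = -a - 1`, the time considered is `-M`; `N` is the binary
  -- logarithm of `M`.
  set M : ℕ := 2 ^ d * (2 * a + 3) with hM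
  have hpos : 0 < 2 ^ d := by positivity
  have hM0 : M ≠ 0 := by positivity
  have h1 : 2 ^ Nat.log 2 M ≤ M := Nat.pow_log_le_self 2 hM0
  have h2 : M < 2 ^ (Nat.log 2 M + 1) := Nat.lt_pow_succ_log_self (by norm_num) M
  have h3 : d + 1 ≤ Nat.log 2 M := by
    refine Nat.le_log_of_pow_le (by norm_num) ?_
    rw [pow_succ]; nlinarith
  generalize Nat.log 2 M = N at h1 h2 h3
  -- The odd factor `2a + 3` exceeds `1`; this is where `n < 0` matters, since at `n = 0` the time
  -- is `-2^(d-1)` itself.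
  have h4 : 2 ^ N ≠ M := by
    intro h
    rw [hM, show N = d + (N - d - 1 + 1) by omega, pow_add, pow_succ] at h
    have := Nat.eq_of_mul_eq_mul_left hpos h
    omega
  have h5 : (2 : ℤ) ^ N + 1 ≤ 2 ^ d * (2 * a + 3) := by
    have : 2 ^ N + 1 ≤ M := by omega
    rw [hM] at this
    exact_mod_cast this
  have h6 : (2 : ℤ) ^ d * (2 * a + 3) + 1 ≤ 2 ^ (N + 1) := by
    have : M + 1 ≤ 2 ^ (N + 1) := h2
    rw [hM] at this
    exact_mod_cast this
  refine ⟨N, h3, ?_⟩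
  have e : ((2 : ℤ) ^ (d + 1) * (-(a : ℤ) - 1) - 2 ^ (d + 1 - 1)) = -(2 ^ d * (2 * a + 3)) := by
    rw [Nat.add_sub_cancel]; ring
  rw [slowIndex_eq interlinkTime_strictMono interlinkTime_zero _
    ⟨2 * -(N : ℤ) - 1, by omega⟩]
  · ring
  · change interlinkVal (2 * -(N : ℤ) - 1 - 1) + 1 ≤
      (2 : ℤ) ^ (d + 1) * (-(a : ℤ) - 1) - 2 ^ (d + 1 - 1)
    rw [e, show 2 * -(N : ℤ) - 1 - 1 = 2 * (-(N : ℤ) - 1) by ring,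
      interlinkVal_even _ (by omega), show (-(N : ℤ) - 1).natAbs = N + 1 by omega]
    linarith
  · change (2 : ℤ) ^ (d + 1) * (-(a : ℤ) - 1) - 2 ^ (d + 1 - 1) ≤
      interlinkVal (2 * -(N : ℤ) - 1)
    rw [e, interlinkVal_odd _ (by omega), show (-(N : ℤ)).natAbs = N by omega]
    linarith

theorem NegFiltration.comp_congr {Ω : Type u} [MeasurableSpace Ω] {P : Measure Ω}
    (F : NegFiltration P) {s t : NonposInt → NonposInt} (hs : Monotone s) (ht : Monotone t)
    (h : ∀ n, s n = t n) : F.comp s hs = F.comp t ht := by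
  obtain rfl : s = t := funext h
  rfl

theorem exists_forall_le_of_strictMono {φ : NonposInt → NonposInt} (hφ : StrictMono φ)
    (m : NonposInt) : ∃ n, φ n ≤ m := ⟨m, le_self_of_strictMono hφ m⟩

end TimeChange

/-! ### The two extractions -/

section Main

variable {Ω : Type u} [MeasurableSpace Ω] {P : Measure Ω} [IsProbabilityMeasure P]
  {F : NegFiltration P}

theorem IsStandard.of_slow_extract_dyadicTime (d : ℕ)
    (h : IsStandard ((F.slow interlinkTime interlinkTime_strictMono interlinkTime_zero).extract
      (dyadicTime d) (dyadicTime_strictMono d))) : IsStandard F := by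
  set s : NonposInt → NonposInt := fun n =>
    slowIndex interlinkTime interlinkTime_strictMono interlinkTime_zero (dyadicTime d n) with hs
  have hsm : Monotone s := (slowIndex_mono _ _).comp (dyadicTime_strictMono d).monotone
  -- Every index up to `-2d - 2` is visited, so a further extraction yields `F` shifted by `2d + 2`.
  have hex : ∀ n, ∃ t, s t = pred^[2 * d + 2] n := fun n =>
    exists_slowIndex_dyadicTime d (by
      rw [coe_iterate_pred]; have := n.2; push_cast; omega)
  choose t ht using hex
  have htm : StrictMono t := by
    intro a b hab
    by_contra! hcon
    have h1 := hsm hcon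
    rw [ht, ht, ← Subtype.coe_le_coe, coe_iterate_pred, coe_iterate_pred] at h1
    rw [← Subtype.coe_lt_coe] at hab
    omega
  have h1 : IsStandard ((F.comp s hsm).comp t htm.monotone) :=
    IsStandard.comp (F := F.comp s hsm) h htm.monotone (exists_forall_le_of_strictMono htm)
  exact IsStandard.of_comp_iterate_pred (2 * d + 2) (hsm.comp htm.monotone) ht h1

theorem IsAtThreshold.isStandard_slow_extract_shiftedDyadicTime (hF : IsAtThreshold F) {d : ℕ}
    (hd : 1 ≤ d) :
    IsStandard ((F.slow interlinkTime interlinkTime_strictMono interlinkTime_zero).extract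
      (shiftedDyadicTime d) (shiftedDyadicTime_strictMono d)) := by
  set s : NonposInt → NonposInt := fun n =>
    slowIndex interlinkTime interlinkTime_strictMono interlinkTime_zero (shiftedDyadicTime d n)
    with hs
  have hsm : Monotone s := (slowIndex_mono _ _).comp (shiftedDyadicTime_strictMono d).monotone
  have h0 : -2 * (d : ℤ) - 1 < s 0 := slowIndex_shiftedDyadicTime_zero hd
  -- The range of `ψ` is `s 0` followed by the odd indices `-2d-1, -2d-3, …`. The value `s 0` is
  -- kept apart because it is even when `d ≥ 2`.
  let ψ : NonposInt → NonposInt := fun n =>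
    if hn : (n : ℤ) = 0 then s 0 else ⟨2 * n - 2 * d + 1, by have := n.2; omega⟩
  have hψ0 : ψ 0 = s 0 := dif_pos rfl
  have hψ : ∀ n : NonposInt, (n : ℤ) < 0 → (ψ n : ℤ) = 2 * n - 2 * d + 1 := by
    intro n hn
    simp only [ψ]
    rw [dif_neg hn.ne]
  have hψm : StrictMono ψ := by
    intro a b hab
    have hb := b.2
    rw [← Subtype.coe_lt_coe] at hab ⊢
    have ha := hψ a (by omega)
    rcases hb.eq_or_lt with hb | hb
    · obtain rfl : b = 0 := Subtype.ext hb
      rw [hψ0]; omega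
    · have := hψ b hb
      omega
  have hinf : (Set.range ψ)ᶜ.Infinite := by
    refine Set.infinite_of_injective_forall_mem
      -- The even indices from `-2d - 2` downwards are skipped.
      (f := fun i : ℕ => (⟨-2 * d - 2 - 2 * i, by omega⟩ : NonposInt)) ?_ ?_
    · intro i j hij
      have := congrArg Subtype.val hij
      simp only at this
      omega
    · rintro i ⟨n, hn⟩
      have h1 := congrArg Subtype.val hn
      rcases n.2.eq_or_lt with hb | hb
      · obtain rfl : n = 0 := Subtype.ext hb
        rw [hψ0] at h1
        simp only at h1
        omega
      · have := hψ n hb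
        simp only at h1
        omega
  have hex : ∀ n, ∃ m, ψ m = s n := by
    intro n
    rcases n.2.eq_or_lt with hb | hb
    · obtain rfl : n = 0 := Subtype.ext hb
      exact ⟨0, hψ0⟩
    · obtain ⟨N, hN, e⟩ := slowIndex_shiftedDyadicTime_of_neg hd hb
      refine ⟨⟨(d : ℤ) - N - 1, by omega⟩, Subtype.ext ?_⟩
      rw [hψ _ (by simp only; omega)]
      simp only [hs]
      rw [e]; ring
  -- `s` repeats values when several times fall in one block, so it is `ψ` composed with a map `r`
  -- that is only non-decreasing.
  choose r hr using hex
  have hrm : Monotone r := fun a b hab => by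
    rw [← hψm.le_iff_le, hr, hr]; exact hsm hab
  have hr' : ∀ m, ∃ n, r n ≤ m := by
    intro m
    -- The shifted dyadic time of this witness is no later than the end of the block of index `ψ m`,
    -- so `s` is at most `ψ m` there.
    refine ⟨interlinkTime (ψ m), ?_⟩
    rw [← hψm.le_iff_le, hr]
    exact slowIndex_le _ _ (le_self_of_strictMono (shiftedDyadicTime_strictMono d) _)
  have h1 := (hF.2 ψ hψm hinf).comp hrm hr'
  rwa [show (F.extract ψ hψm).comp r hrm = F.comp (fun n => ψ (r n)) (hψm.monotone.comp hrm) from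
    rfl, F.comp_congr _ hsm hr] at h1

end Main

end Standardness

theorem mainTheorem10 {Ω : Type u} [MeasurableSpace Ω] (P : Measure Ω) [IsProbabilityMeasure P]
    (F : Standardness.NegFiltration P) (hF : Standardness.IsAtThreshold F)
    (G : Standardness.NegFiltration P)
    (hG : G = F.slow Standardness.interlinkTime Standardness.interlinkTime_strictMono
      Standardness.interlinkTime_zero)
    (d : ℕ) (hd : 1 ≤ d) :
    ¬ Standardness.IsStandard
        (G.extract (Standardness.dyadicTime d) (Standardness.dyadicTime_strictMono d)) ∧
      Standardness.IsStandard
        (G.extract (Standardness.shiftedDyadicTime d)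
          (Standardness.shiftedDyadicTime_strictMono d)) := by
  subst hG
  exact ⟨fun h => hF.1 (h.of_slow_extract_dyadicTime d),
    hF.isStandard_slow_extract_shiftedDyadicTime hd⟩
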